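/- **Giant-connecting lemma.** For a graph $\Gamma$, let $T_1(\Gamma)$ be the graph whose vertices are the non-edges of $\Gamma$, two non-edges $f,f'$ being adjacent when $f\cup f'$ induces a $4$-cycle in $\Gamma$. The size of a component of $T_1(\Gamma)$ is the number of non-edges it contains. For $W\subseteq V(\Gamma)$, $\Gamma[W]$ is the subgraph induced by $W$. Let $\mathcal G_{n,p}$ be the binomial random graph on $n$ vertices. For every $c>0$ there is $\kappa=\kappa(c)>0$ such that the following holds. Let $p=p(n)\in[0,1]$ and $M=M(n)>0$ satisfy $$\frac1{\sqrt n}\ll p\le 100\Big(\frac{\log n}{n}\Big)^{1/3},\qquad 1\ll M\ll \frac1p ,$$ where $f\ll g$ means $f(n)/g(n)\to0$ as $n\to\infty$. Let $\Gamma\sim\mathcal G_{n,p}$. Then for all sufficiently large $n$ (depending on $c$ and on the functions $p$ and $M$), for every partition $W_1\sqcup W_2$ of $V(\Gamma)$ with $|W_1|=n/M$ up to rounding (that is, $\big||W_1|-n/M\big|<1$), and for every graph $H$ on $W_2$, the following hold conditionally on $\Gamma[W_2]=H$: 1. For every component $C_2$ of $T_1(H)$ of size at least $cn^2$, the probability that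 there is a component $C_1$ of $T_1(\Gamma[W_1])$ of size at least $M$ such that $C_1$ and $C_2$ are not subsets of the same component of $T_1(\Gamma)$ is at most $$\frac{n^2}{M^3}\exp\left(-\kappa Mnp^2\right).$$ 2. With probability at least $1-\exp(-\kappa n^2p^2)$, any two distinct components $C_2,C_2'$ of $T_1(H)$ of size at least $cn^2$ are subsets of the same component of $T_1(\Gamma)$. -/

import Mathlib

open Filter Asymptotics ProbabilityTheory

/-- The square graph `T₁(Γ)`: its vertices are the non-edges of `Γ` (the edges of the complement),
and two non-edges `f`, `f'` are adjacent when the vertex set `f ∪ f'` induces a `4`-cycle in `Γ`. -/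
def squareGraph {V : Type*} (Γ : SimpleGraph V) : SimpleGraph Γᶜ.edgeSet where
  Adj f f' := Nonempty (Γ.induce {v | v ∈ f.1 ∨ v ∈ f'.1} ≃g SimpleGraph.cycleGraph 4)
  symm := ⟨fun f f' h => by
    have e : {v | v ∈ f.1 ∨ v ∈ f'.1} = {v | v ∈ f'.1 ∨ v ∈ f.1} := Set.ext fun _ => or_comm
    rwa [e] at h⟩
  loopless := ⟨fun f ⟨φ⟩ => by
    obtain ⟨f, hf⟩ := f
    induction f using Sym2.ind with
    | _ x y =>
      have h1 : Nat.card {v | v ∈ s(x, y) ∨ v ∈ s(x, y)} = 4 := by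
        rw [Nat.card_congr φ.toEquiv, Nat.card_fin]
      have h2 : {v | v ∈ s(x, y) ∨ v ∈ s(x, y)} = {x, y} := by ext; simp
      rw [h2, Nat.card_coe_set_eq] at h1
      have := Set.ncard_insert_le x {y}
      rw [Set.ncard_singleton] at this
      omega⟩

/-- A square component of `Γ`: a connected component of `T₁(Γ)`. -/
abbrev SquareComponent {V : Type*} (Γ : SimpleGraph V) : Type _ :=
  (squareGraph Γ).ConnectedComponent

/-- The set of non-edges of `Γ`, as unordered pairs, that belong to the square component `C`. -/
def SquareComponent.pairs {V : Type*} {Γ : SimpleGraph V} (C : SquareComponent Γ) :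
    Set (Sym2 V) :=
  Subtype.val '' C.supp

/-- For a square component `C` of a graph on a subset `W` of `V`, the set of its non-edges,
regarded as unordered pairs of elements of `V`. -/
def SquareComponent.pairsIn {V : Type*} {W : Set V} {H : SimpleGraph W}
    (C : SquareComponent H) : Set (Sym2 V) :=
  Sym2.map Subtype.val '' C.pairs

/-- The number of non-edges in the square component `C`. -/
noncomputable def SquareComponent.size {V : Type*} {Γ : SimpleGraph V}
    (C : SquareComponent Γ) : ℕ :=
  C.pairs.ncard

/-- The sets of pairs `P` and `Q` are subsets of the same component of `T₁(Γ)`. -/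
def InSameSquareComponent {V : Type*} (Γ : SimpleGraph V) (P Q : Set (Sym2 V)) : Prop :=
  ∃ D : SquareComponent Γ, P ⊆ D.pairs ∧ Q ⊆ D.pairs

/-! If all four edges between two non-edges `f` and `g` are present, then `f ∪ g` induces a 4-cycle.
So two components living on `W₁` and `W₂` merge as soon as some pair of one is completely joined to
some pair of the other. Given both induced subgraphs, the edges between `W₁` and `W₂` are still
independent, so conditioning costs nothing (`cond_binomialRandom_real_le`).

The main estimate comes from `janson_inequality`. Let `F` and `G` be families of pairs in `W₁` and
`W₂`, where every vertex has degree at most `1/p` in `F`, and let `np² ≥ 1`. Then no pair of `F` is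
completely joined to a pair of `G` with probability at most `exp(-|F||G|p²/(18n))`. For `|G| ≥ cn²`
this is at most `exp(-c|F|np²/18)`.

For the first claim, a component on `W₁` with at least `M` pairs contains a family `F` of `⌈M⌉`
pairs, whose degrees are trivially at most `M + 1 ≤ 1/p`. Components are disjoint, so there are at
most `n²/M³` of them, and a union bound finishes.

For the second claim, all but exceptionally at least half of the pairs in `W₁` are non-edges, and
among these there is a family `F` of degree at most `⌈M⌉` with `|F| ≥ n/48`. Two large components
merge if a single `f ∈ F` is joined to both. Otherwise at least half of `F` misses the same
component. A union bound over at most `1/c` components and `2^|F|` subfamilies is affordable because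
`np²` is large compared with `1/c`. -/

/-! ### Random subsets: Harris' and Janson's inequalities. -/

section SubsetExpect

variable {α β ι : Type*}

/-- The expectation of `f S`, where `S` is a random subset of `U` containing each element
independently with probability `p`. -/
noncomputable def subsetExpect (p : ℝ) (U : Finset α) (f : Finset α → ℝ) : ℝ :=
  ∑ S ∈ U.powerset, p ^ S.card * (1 - p) ^ (U.card - S.card) * f S

lemma subsetExpect_congr {p : ℝ} {U : Finset α} {f g : Finset α → ℝ}
    (h : ∀ S ⊆ U, f S = g S) : subsetExpect p U f = subsetExpect p U g :=
  Finset.sum_congr rfl fun S hS => by rw [h S (Finset.mem_powerset.1 hS)]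

lemma subsetExpect_mono {p : ℝ} (h0 : 0 ≤ p) (h1 : p ≤ 1) {U : Finset α} {f g : Finset α → ℝ}
    (h : ∀ S ⊆ U, f S ≤ g S) : subsetExpect p U f ≤ subsetExpect p U g :=
  Finset.sum_le_sum fun S hS => mul_le_mul_of_nonneg_left (h S (Finset.mem_powerset.1 hS))
    (mul_nonneg (pow_nonneg h0 _) (pow_nonneg (by linarith) _))

lemma subsetExpect_const (p : ℝ) (U : Finset α) (c : ℝ) :
    subsetExpect p U (fun _ => c) = c := by
  rw [subsetExpect, ← Finset.sum_mul, Finset.sum_pow_mul_eq_add_pow]; simp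

lemma subsetExpect_mul_left (p : ℝ) (U : Finset α) (c : ℝ) (f : Finset α → ℝ) :
    subsetExpect p U (fun S => c * f S) = c * subsetExpect p U f := by
  rw [subsetExpect, subsetExpect, Finset.mul_sum]
  exact Finset.sum_congr rfl fun _ _ => by ring

lemma subsetExpect_add (p : ℝ) (U : Finset α) (f g : Finset α → ℝ) :
    subsetExpect p U (fun S => f S + g S) = subsetExpect p U f + subsetExpect p U g := by
  rw [subsetExpect, subsetExpect, subsetExpect, ← Finset.sum_add_distrib]
  exact Finset.sum_congr rfl fun _ _ => by ring

lemma subsetExpect_sum (p : ℝ) (U : Finset α) (I : Finset ι) (f : ι → Finset α → ℝ) :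
    subsetExpect p U (fun S => ∑ i ∈ I, f i S) = ∑ i ∈ I, subsetExpect p U (f i) := by
  simp only [subsetExpect, Finset.mul_sum]
  exact Finset.sum_comm

lemma subsetExpect_nonneg {p : ℝ} (h0 : 0 ≤ p) (h1 : p ≤ 1) {U : Finset α} {f : Finset α → ℝ}
    (h : ∀ S ⊆ U, 0 ≤ f S) : 0 ≤ subsetExpect p U f := by
  simpa [subsetExpect_const] using subsetExpect_mono h0 h1 (f := fun _ => 0) h

lemma subsetExpect_le_of_le {p : ℝ} (h0 : 0 ≤ p) (h1 : p ≤ 1) {U : Finset α} {f : Finset α → ℝ}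
    {c : ℝ} (h : ∀ S ⊆ U, f S ≤ c) : subsetExpect p U f ≤ c := by
  simpa [subsetExpect_const] using subsetExpect_mono h0 h1 (g := fun _ => c) h

lemma subsetExpect_empty (p : ℝ) (f : Finset α → ℝ) : subsetExpect p ∅ f = f ∅ := by
  simp [subsetExpect]

variable [DecidableEq α]

lemma subsetExpect_insert (p : ℝ) {U : Finset α} {a : α} (ha : a ∉ U) (f : Finset α → ℝ) :
    subsetExpect p (insert a U) f =
      p * subsetExpect p U (fun S => f (insert a S)) + (1 - p) * subsetExpect p U f := by
  simp only [subsetExpect]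
  rw [Finset.sum_powerset_insert ha, add_comm, Finset.mul_sum, Finset.mul_sum]
  congr 1
  · refine Finset.sum_congr rfl fun S hS => ?_
    have hS' := Finset.mem_powerset.1 hS
    rw [Finset.card_insert_of_notMem ha, Finset.card_insert_of_notMem fun h => ha (hS' h),
      Nat.add_sub_add_right]
    ring
  · refine Finset.sum_congr rfl fun S hS => ?_
    have := Finset.card_le_card (Finset.mem_powerset.1 hS)
    rw [Finset.card_insert_of_notMem ha, Nat.succ_sub this, pow_succ]
    ring

/-- Independence of disjoint coordinate sets, as a Fubini identity; it is what allows edges to be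
exposed in stages. -/
lemma subsetExpect_union (p : ℝ) {U W : Finset α} (h : Disjoint U W) (f : Finset α → ℝ) :
    subsetExpect p (U ∪ W) f =
      subsetExpect p U (fun S => subsetExpect p W fun T => f (S ∪ T)) := by
  induction U using Finset.induction_on generalizing f with
  | empty => simp [subsetExpect_empty]
  | insert a U ha ih =>
    rw [Finset.disjoint_insert_left] at h
    rw [Finset.insert_union, subsetExpect_insert p (by simp [ha, h.1]), subsetExpect_insert p ha,
      ih h.2, ih h.2]
    simp only [Finset.insert_union]

lemma subsetExpect_image [DecidableEq β] (p : ℝ) (U : Finset β)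
    {e : β → α} (he : Set.InjOn e U) (f : Finset α → ℝ) :
    subsetExpect p (U.image e) f = subsetExpect p U (fun S => f (S.image e)) := by
  induction U using Finset.induction_on generalizing f with
  | empty => simp [subsetExpect_empty]
  | insert a U ha ih =>
    have ha' : e a ∉ U.image e := by
      rw [Finset.mem_image]
      rintro ⟨b, hb, hab⟩
      exact ha (he (by simp [hb]) (by simp) hab ▸ hb)
    have he' := he.mono (Finset.coe_subset.2 (Finset.subset_insert a U))
    rw [Finset.image_insert, subsetExpect_insert p ha', subsetExpect_insert p ha, ih he', ih he']
    simp only [Finset.image_insert]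

/-- Conditioning a random subset on containing `A`. -/
lemma subsetExpect_ite_subset (p : ℝ) {U A : Finset α} (hA : A ⊆ U) (f : Finset α → ℝ) :
    subsetExpect p U (fun S => if A ⊆ S then f S else 0) =
      p ^ A.card * subsetExpect p U (fun S => f (S ∪ A)) := by
  have hU : U = (U \ A) ∪ A := (Finset.sdiff_union_of_subset hA).symm
  have hd : Disjoint (U \ A) A := Finset.sdiff_disjoint
  rw [hU, subsetExpect_union p hd, subsetExpect_union p hd, ← subsetExpect_mul_left]
  refine subsetExpect_congr fun S hS => ?_
  have hSA : Disjoint S A := Finset.disjoint_of_subset_left hS hd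
  have h1 : subsetExpect p A (fun T => f (S ∪ T ∪ A)) = f (S ∪ A) := by
    rw [← subsetExpect_const p A (f (S ∪ A))]
    refine subsetExpect_congr fun T hT => ?_
    rw [Finset.union_assoc, Finset.union_eq_right.2 hT]
  rw [h1, subsetExpect, Finset.sum_eq_single A]
  · simp
  · intro T hT hTA
    have hT := Finset.mem_powerset.1 hT
    rw [if_neg, mul_zero]
    intro h
    refine hTA (hT.antisymm fun a ha => ?_)
    rcases Finset.mem_union.1 (h ha) with h | h
    · exact absurd ha (Finset.disjoint_left.1 hSA h)
    · exact h
  · simp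

lemma subsetExpect_indicator_subset (p : ℝ) {U A : Finset α} (hA : A ⊆ U) :
    subsetExpect p U (fun S => if A ⊆ S then 1 else 0) = p ^ A.card := by
  rw [subsetExpect_ite_subset p hA, subsetExpect_const, mul_one]

/-- **Harris' inequality** for two decreasing functions of a random subset. -/
lemma subsetExpect_mul_le_of_antitone {p : ℝ} (h0 : 0 ≤ p) (h1 : p ≤ 1) (U : Finset α)
    {f g : Finset α → ℝ} (hf : Antitone f) (hg : Antitone g) :
    subsetExpect p U f * subsetExpect p U g ≤ subsetExpect p U (fun S => f S * g S) := by
  induction U using Finset.induction_on generalizing f g with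
  | empty => simp [subsetExpect_empty]
  | insert a U ha ih =>
    rw [subsetExpect_insert p ha, subsetExpect_insert p ha, subsetExpect_insert p ha]
    have hm : Monotone fun S : Finset α => insert a S := fun S T h => Finset.insert_subset_insert a h
    have k1 := ih hf hg
    have k2 := ih (hf.comp_monotone hm) (hg.comp_monotone hm)
    have kf : subsetExpect p U (fun S => f (insert a S)) ≤ subsetExpect p U f :=
      subsetExpect_mono h0 h1 fun S _ => hf (Finset.subset_insert a S)
    have kg : subsetExpect p U (fun S => g (insert a S)) ≤ subsetExpect p U g :=
      subsetExpect_mono h0 h1 fun S _ => hg (Finset.subset_insert a S)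
    simp only [Function.comp_def] at k2
    set a1 := subsetExpect p U (fun S => f (insert a S))
    set a0 := subsetExpect p U f
    set b1 := subsetExpect p U (fun S => g (insert a S))
    set b0 := subsetExpect p U g
    have e1 := mul_le_mul_of_nonneg_left k1 (sub_nonneg.2 h1)
    have e2 := mul_le_mul_of_nonneg_left k2 h0
    -- This is the covariance of the two conditional expectations given whether `a` is chosen; both
    -- drop when `a` is added.
    have e3 : 0 ≤ (p * (1 - p)) * ((a0 - a1) * (b0 - b1)) :=
      mul_nonneg (mul_nonneg h0 (sub_nonneg.2 h1)) (mul_nonneg (sub_nonneg.2 kf) (sub_nonneg.2 kg))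
    nlinarith

/-- The number of sets of the family `A` contained in `S`. -/
noncomputable def containedCount (I : Finset ι) (A : ι → Finset α) (S : Finset α) : ℝ :=
  ∑ i ∈ I, if A i ⊆ S then 1 else 0

lemma containedCount_mono (I : Finset ι) (A : ι → Finset α) : Monotone (containedCount I A) := by
  intro S T h
  refine Finset.sum_le_sum fun i _ => ?_
  split_ifs with h1 h2
  · exact le_rfl
  · exact absurd (h1.trans h) h2
  · exact zero_le_one
  · exact le_rfl

lemma antitone_exp_neg_containedCount (I : Finset ι) (A : ι → Finset α) {s : ℝ} (hs : 0 ≤ s) :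
    Antitone fun S => Real.exp (-(s * containedCount I A S)) := fun _ _ h =>
  Real.exp_le_exp.2 (neg_le_neg (mul_le_mul_of_nonneg_left (containedCount_mono I A h) hs))

/-- The heart of Janson's inequality. The sets disjoint from `A i` do not feel the conditioning on
`A i ⊆ S`; those meeting it are controlled by `exp(-x) ≥ 1 - x`; Harris' inequality separates the
two contributions. The sum includes the diagonal term `j = i`. -/
lemma subsetExpect_exp_neg_containedCount_ge {p : ℝ} (h0 : 0 ≤ p) (h1 : p ≤ 1) (U : Finset α) (I : Finset ι)
    (A : ι → Finset α) (hA : ∀ i ∈ I, A i ⊆ U) {s : ℝ} (hs : 0 ≤ s) {i : ι} (hi : i ∈ I) :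
    (p ^ (A i).card - s * ∑ j ∈ I with ¬ Disjoint (A i) (A j), p ^ (A i ∪ A j).card) *
        subsetExpect p U (fun S => Real.exp (-(s * containedCount I A S))) ≤
      subsetExpect p U
        (fun S => if A i ⊆ S then Real.exp (-(s * containedCount I A S)) else 0) := by
  set I' := I.filter fun j => ¬ Disjoint (A i) (A j)
  set I'' := I.filter fun j => Disjoint (A i) (A j)
  have hsplit : ∀ S, containedCount I A S = containedCount I' A S + containedCount I'' A S := by
    intro S
    simp only [containedCount, I', I'']
    rw [add_comm, Finset.sum_filter_add_sum_filter_not]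
  have hind : ∀ S, containedCount I'' A (S ∪ A i) = containedCount I'' A S := by
    intro S
    refine Finset.sum_congr rfl fun j hj => ?_
    have hd : Disjoint (A j) (A i) := (Finset.mem_filter.1 hj).2.symm
    have : A j ⊆ S ∪ A i ↔ A j ⊆ S :=
      ⟨fun h => hd.left_le_of_le_sup_right h, fun h => h.trans Finset.subset_union_left⟩
    simp only [this]
  have hm : Monotone fun S : Finset α => S ∪ A i := fun S T h => Finset.union_subset_union_left h
  have hpos : 0 ≤ subsetExpect p U (fun S => Real.exp (-(s * containedCount I A S))) :=
    subsetExpect_nonneg h0 h1 fun S _ => (Real.exp_pos _).le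
  have hI'' : subsetExpect p U (fun S => Real.exp (-(s * containedCount I A S))) ≤
      subsetExpect p U (fun S => Real.exp (-(s * containedCount I'' A S))) := by
    refine subsetExpect_mono h0 h1 fun S _ => Real.exp_le_exp.2 ?_
    have : 0 ≤ containedCount I' A S := Finset.sum_nonneg fun j _ => by split_ifs <;> norm_num
    rw [hsplit]
    nlinarith
  have hfirst : p ^ (A i).card - s * ∑ j ∈ I', p ^ (A i ∪ A j).card ≤
      subsetExpect p U
        (fun S => if A i ⊆ S then Real.exp (-(s * containedCount I' A S)) else 0) := by
    have e1 : ∑ j ∈ I', p ^ (A i ∪ A j).card = subsetExpect p U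
        (fun S => if A i ⊆ S then containedCount I' A S else 0) := by
      have : (fun S => if A i ⊆ S then containedCount I' A S else 0) =
          fun S => ∑ j ∈ I', if A i ∪ A j ⊆ S then (1 : ℝ) else 0 := by
        funext S
        by_cases h : A i ⊆ S <;> simp [containedCount, Finset.union_subset_iff, h]
      rw [this, subsetExpect_sum]
      refine Finset.sum_congr rfl fun j hj => ?_
      rw [subsetExpect_indicator_subset p
        (Finset.union_subset (hA i hi) (hA j (Finset.mem_filter.1 hj).1))]
    rw [e1, ← subsetExpect_indicator_subset p (hA i hi), sub_eq_add_neg, ← neg_mul,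
      ← subsetExpect_mul_left, ← subsetExpect_add]
    refine subsetExpect_mono h0 h1 fun S _ => ?_
    by_cases h : A i ⊆ S
    · simp only [h, if_true]
      have := Real.add_one_le_exp (-(s * containedCount I' A S))
      linarith
    · simp [h]
  calc _ ≤ subsetExpect p U
        (fun S => if A i ⊆ S then Real.exp (-(s * containedCount I' A S)) else 0) *
        subsetExpect p U (fun S => Real.exp (-(s * containedCount I A S))) :=
        mul_le_mul_of_nonneg_right hfirst hpos
    _ ≤ subsetExpect p U
        (fun S => if A i ⊆ S then Real.exp (-(s * containedCount I' A S)) else 0) *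
        subsetExpect p U (fun S => Real.exp (-(s * containedCount I'' A S))) :=
        mul_le_mul_of_nonneg_left hI'' (subsetExpect_nonneg h0 h1 fun S _ => by
          split_ifs
          exacts [(Real.exp_pos _).le, le_rfl])
    _ = p ^ (A i).card * (subsetExpect p U (fun S => Real.exp (-(s * containedCount I' A (S ∪ A i)))) *
        subsetExpect p U (fun S => Real.exp (-(s * containedCount I'' A (S ∪ A i))))) := by
        rw [subsetExpect_ite_subset p (hA i hi)]
        simp only [hind]
        ring
    -- Harris' inequality under the measure conditioned on containing `A i`; both exponentials are
    -- decreasing.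
    _ ≤ p ^ (A i).card * subsetExpect p U (fun S => Real.exp (-(s * containedCount I' A (S ∪ A i))) *
          Real.exp (-(s * containedCount I'' A (S ∪ A i)))) := by
        refine mul_le_mul_of_nonneg_left ?_ (pow_nonneg h0 _)
        exact subsetExpect_mul_le_of_antitone h0 h1 U
          ((antitone_exp_neg_containedCount I' A hs).comp_monotone hm)
          ((antitone_exp_neg_containedCount I'' A hs).comp_monotone hm)
    _ = _ := by
        rw [subsetExpect_ite_subset p (hA i hi)]
        congr 1
        refine subsetExpect_congr fun S _ => ?_
        rw [← Real.exp_add, hsplit]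
        congr 1
        ring

/-- **Janson's inequality**: an upper bound for the probability that a random subset contains no
member of a given family of sets. -/
theorem janson_inequality {p : ℝ} (h0 : 0 ≤ p) (h1 : p ≤ 1) (U : Finset α) (I : Finset ι)
    (A : ι → Finset α) (hA : ∀ i ∈ I, A i ⊆ U) {μ D : ℝ} (hμ : 0 ≤ μ) (hD : 0 < D)
    (hμI : μ ≤ ∑ i ∈ I, p ^ (A i).card)
    (hDI : ∑ i ∈ I, ∑ j ∈ I with ¬ Disjoint (A i) (A j), p ^ (A i ∪ A j).card ≤ D) :
    subsetExpect p U (fun S => if ∀ i ∈ I, ¬ A i ⊆ S then 1 else 0) ≤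
      Real.exp (-(μ ^ 2 / (2 * D))) := by
  -- The Laplace transform of the count bounds the probability that the count is zero, and satisfies
  -- `ψ' ≤ -(μ - sD)ψ`.
  set ψ : ℝ → ℝ := fun s => subsetExpect p U (fun S => Real.exp (-(s * containedCount I A S)))
  set ψ' : ℝ → ℝ := fun s => subsetExpect p U
    (fun S => Real.exp (-(s * containedCount I A S)) * -containedCount I A S)
  have hψ : ∀ s, HasDerivAt ψ (ψ' s) s := by
    intro s
    refine HasDerivAt.fun_sum fun S _ => HasDerivAt.const_mul _ ?_
    have : HasDerivAt (fun s => -(s * containedCount I A S)) (-containedCount I A S) s := by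
      simpa using (hasDerivAt_mul_const (containedCount I A S) (x := s)).fun_neg
    exact this.exp
  have hψ' : ∀ s, 0 ≤ s → ψ' s ≤ -((μ - s * D) * ψ s) := by
    intro s hs
    have e : ψ' s = -∑ i ∈ I, subsetExpect p U
        (fun S => if A i ⊆ S then Real.exp (-(s * containedCount I A S)) else 0) := by
      rw [← subsetExpect_sum, ← neg_one_mul, ← subsetExpect_mul_left]
      refine subsetExpect_congr fun S _ => ?_
      rw [← Finset.sum_filter, Finset.sum_const, nsmul_eq_mul, containedCount,
        Finset.sum_boole]
      ring
    rw [e, neg_le_neg_iff]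
    refine le_trans ?_ (Finset.sum_le_sum fun i hi => subsetExpect_exp_neg_containedCount_ge h0 h1 U I A hA hs hi)
    rw [← Finset.sum_mul, Finset.sum_sub_distrib, ← Finset.mul_sum]
    refine mul_le_mul_of_nonneg_right ?_ (subsetExpect_nonneg h0 h1 fun S _ => (Real.exp_pos _).le)
    have := mul_le_mul_of_nonneg_left hDI hs
    linarith
  -- Integrating factor: the differential inequality says exactly that `φ` decreases on `[0, ∞)`.
  set φ : ℝ → ℝ := fun s => ψ s * Real.exp (μ * s - s ^ 2 * D / 2)
  have hφ : ∀ s, HasDerivAt φ (ψ' s * Real.exp (μ * s - s ^ 2 * D / 2) +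
      ψ s * (Real.exp (μ * s - s ^ 2 * D / 2) * (μ - s * D))) s := by
    intro s
    refine (hψ s).mul (HasDerivAt.exp ?_)
    have k1 : HasDerivAt (fun s : ℝ => μ * s) μ s := by
      simpa using (hasDerivAt_id s).const_mul μ
    have k2 : HasDerivAt (fun s : ℝ => s ^ 2 * D / 2) (s * D) s := by
      refine (((hasDerivAt_pow 2 s).mul_const D).div_const 2).congr_deriv ?_
      norm_num
      ring
    exact k1.sub k2
  have hanti : AntitoneOn φ (Set.Ici 0) := by
    refine antitoneOn_of_deriv_nonpos (convex_Ici 0)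
      (fun s _ => (hφ s).continuousAt.continuousWithinAt)
      (fun s _ => (hφ s).differentiableAt.differentiableWithinAt) fun s hs => ?_
    rw [interior_Ici] at hs
    rw [(hφ s).deriv]
    have := mul_le_mul_of_nonneg_right (hψ' s (le_of_lt hs))
      (Real.exp_pos (μ * s - s ^ 2 * D / 2)).le
    nlinarith
  -- The point `s = μ/D` maximises `μs - s²D/2`.
  have hs : 0 ≤ μ / D := div_nonneg hμ hD.le
  have key := hanti (Set.mem_Ici.2 le_rfl) (Set.mem_Ici.2 hs) hs
  have hφ0 : φ 0 = 1 := by simp [φ, ψ, subsetExpect_const]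
  have hexp : μ * (μ / D) - (μ / D) ^ 2 * D / 2 = μ ^ 2 / (2 * D) := by
    field_simp
    ring
  have hle : ψ (μ / D) ≤ Real.exp (-(μ ^ 2 / (2 * D))) := by
    rw [hφ0] at key
    simp only [φ] at key
    rw [hexp] at key
    rw [Real.exp_neg, ← one_div, le_div_iff₀ (Real.exp_pos _)]
    exact key
  refine le_trans (subsetExpect_mono h0 h1 fun S _ => ?_) hle
  split_ifs with h
  · have : containedCount I A S = 0 := Finset.sum_eq_zero fun i hi => if_neg (h i hi)
    simp [this]
  · exact (Real.exp_pos _).le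

end SubsetExpect

/-! ### Square components: how they merge and how many are large. -/

section SquareGraph

variable {V : Type*}

lemma squareGraph_adj_of_complete_bipartite {Γ : SimpleGraph V} {f g : Γᶜ.edgeSet}
    (h : ∀ a ∈ f.1, ∀ x ∈ g.1, Γ.Adj a x) : (squareGraph Γ).Adj f g := by
  obtain ⟨f, hf⟩ := f
  obtain ⟨g, hg⟩ := g
  induction f using Sym2.ind with
  | _ a b =>
  induction g using Sym2.ind with
  | _ x y =>
  rw [SimpleGraph.mem_edgeSet, SimpleGraph.compl_adj] at hf hg
  simp only [Sym2.mem_iff, forall_eq_or_imp, forall_eq] at h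
  obtain ⟨⟨hax, hay⟩, hbx, hby⟩ := h
  -- Cyclic order `a, x, b, y`: the two non-edges become the diagonals of the 4-cycle.
  have hS : ∀ i : Fin 4, ![a, x, b, y] i ∈ {v | v ∈ s(a, b) ∨ v ∈ s(x, y)} := by
    intro i
    fin_cases i <;> simp
  let φ : Fin 4 → {v | v ∈ s(a, b) ∨ v ∈ s(x, y)} := fun i => ⟨![a, x, b, y] i, hS i⟩
  have hφ : Function.Bijective φ := by
    constructor
    · intro i j hij
      have hij : ![a, x, b, y] i = ![a, x, b, y] j := congrArg Subtype.val hij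
      have n1 := hax.ne
      have n2 := hay.ne
      have n3 := hbx.ne
      have n4 := hby.ne
      have n5 := hf.1
      have n6 := hg.1
      fin_cases i <;> fin_cases j <;> simp at hij ⊢ <;>
        first
          | exact absurd hij ‹_›
          | exact absurd hij.symm ‹_›
    · rintro ⟨v, hv⟩
      simp only [Set.mem_ofPred_eq, Sym2.mem_iff] at hv
      rcases hv with (rfl | rfl) | (rfl | rfl)
      exacts [⟨0, rfl⟩, ⟨2, rfl⟩, ⟨1, rfl⟩, ⟨3, rfl⟩]
  refine ⟨(SimpleGraph.Iso.symm ⟨Equiv.ofBijective φ hφ, ?_⟩)⟩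
  intro i j
  have m1 := hf.2
  have m2 := hg.2
  have m1' : ¬ Γ.Adj b a := fun h => m1 h.symm
  have m2' : ¬ Γ.Adj y x := fun h => m2 h.symm
  -- The 4-cycle is complete bipartite between even and odd positions.
  have hc : ∀ i j : Fin 4, (SimpleGraph.cycleGraph 4).Adj i j ↔ (i.val + j.val) % 2 = 1 := by decide
  simp only [Equiv.ofBijective_apply, SimpleGraph.comap_adj, Function.Embedding.subtype_apply, φ,
    hc]
  fin_cases i <;> fin_cases j <;>
    simp [hax, hay, hbx, hby, hax.symm, hay.symm, hbx.symm, hby.symm, m1, m2, m1', m2']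

lemma map_val_mem_compl_edgeSet {Γ : SimpleGraph V} {W : Set V} {f : Sym2 W}
    (hf : f ∈ (Γ.induce W)ᶜ.edgeSet) : Sym2.map Subtype.val f ∈ Γᶜ.edgeSet := by
  induction f using Sym2.ind with
  | _ a b =>
    rw [SimpleGraph.mem_edgeSet, SimpleGraph.compl_adj] at hf
    rw [Sym2.map_mk, SimpleGraph.mem_edgeSet, SimpleGraph.compl_adj]
    exact ⟨fun h => hf.1 (Subtype.ext h), hf.2⟩

/-- The square graph of an induced subgraph maps into the square graph. -/
def squareGraphInduceHom (Γ : SimpleGraph V) (W : Set V) :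
    squareGraph (Γ.induce W) →g squareGraph Γ where
  toFun f := ⟨Sym2.map Subtype.val f.1, map_val_mem_compl_edgeSet f.2⟩
  map_rel' := by
    rintro f g ⟨φ⟩
    refine ⟨RelIso.trans (SimpleGraph.Iso.symm
      ⟨Equiv.ofBijective (fun v => ⟨v.1.1, ?_⟩) ⟨?_, ?_⟩, ?_⟩) φ⟩
    · rcases v.2 with h | h
      · exact Or.inl (Sym2.mem_map.2 ⟨_, h, rfl⟩)
      · exact Or.inr (Sym2.mem_map.2 ⟨_, h, rfl⟩)
    · intro u v h
      exact Subtype.ext (Subtype.ext (Subtype.mk.inj h))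
    · rintro ⟨v, hv⟩
      rcases hv with h | h
      · obtain ⟨w, hw, rfl⟩ := Sym2.mem_map.1 h
        exact ⟨⟨w, Or.inl hw⟩, rfl⟩
      · obtain ⟨w, hw, rfl⟩ := Sym2.mem_map.1 h
        exact ⟨⟨w, Or.inr hw⟩, rfl⟩
    · intro u v
      rfl

/-- A graph homomorphism sends a connected component into a single component. -/
lemma SquareComponent.exists_pairsIn_subset {Γ : SimpleGraph V} {W : Set V}
    (C : SquareComponent (Γ.induce W)) : ∃ D : SquareComponent Γ, C.pairsIn ⊆ D.pairs := by
  refine ⟨C.map (squareGraphInduceHom Γ W), ?_⟩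
  rintro _ ⟨_, ⟨f, hf, rfl⟩, rfl⟩
  refine ⟨squareGraphInduceHom Γ W f, ?_, rfl⟩
  rw [SimpleGraph.ConnectedComponent.mem_supp_iff] at hf ⊢
  rw [← hf]
  rfl

lemma SquareComponent.mem_compl_edgeSet_of_mem_pairsIn {W : Set V} {H : SimpleGraph W}
    {Γ : SimpleGraph V} (hH : Γ.induce W = H) {C : SquareComponent H} {f : Sym2 V}
    (hf : f ∈ C.pairsIn) : f ∈ Γᶜ.edgeSet := by
  subst hH
  obtain ⟨_, ⟨f, hf, rfl⟩, rfl⟩ := hf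
  exact map_val_mem_compl_edgeSet f.2

/-- A component of an induced square graph lies in the square component of every non-edge that is
completely joined to one of its pairs. -/
lemma SquareComponent.pairsIn_subset_of_complete {W : Set V} {H : SimpleGraph W}
    {Γ : SimpleGraph V} (hH : Γ.induce W = H) (C : SquareComponent H) {f g : Sym2 V}
    (hf : f ∈ Γᶜ.edgeSet) (hg : g ∈ C.pairsIn) (h : ∀ a ∈ f, ∀ x ∈ g, Γ.Adj a x) :
    C.pairsIn ⊆ SquareComponent.pairs (Γ := Γ)
      ((squareGraph Γ).connectedComponentMk ⟨f, hf⟩) := by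
  subst hH
  obtain ⟨D, hD⟩ := C.exists_pairsIn_subset
  have hDf : D = (squareGraph Γ).connectedComponentMk ⟨f, hf⟩ := by
    obtain ⟨g', hg', rfl⟩ := hD hg
    rw [SimpleGraph.ConnectedComponent.mem_supp_iff] at hg'
    rw [← hg', SimpleGraph.ConnectedComponent.eq]
    exact (squareGraph_adj_of_complete_bipartite h).symm.reachable
  exact hDf ▸ hD

lemma inSameSquareComponent_of_complete {W₁ W₂ : Set V} {G : SimpleGraph W₁} {H : SimpleGraph W₂}
    {Γ : SimpleGraph V} (hG : Γ.induce W₁ = G) (hH : Γ.induce W₂ = H) {C₁ : SquareComponent G}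
    {C₂ : SquareComponent H} {f g : Sym2 V} (hf : f ∈ C₁.pairsIn) (hg : g ∈ C₂.pairsIn)
    (h : ∀ a ∈ f, ∀ x ∈ g, Γ.Adj a x) : InSameSquareComponent Γ C₁.pairsIn C₂.pairsIn := by
  refine ⟨_, ?_, C₂.pairsIn_subset_of_complete hH
    (SquareComponent.mem_compl_edgeSet_of_mem_pairsIn hG hf) hg h⟩
  subst hG
  obtain ⟨D, hD⟩ := C₁.exists_pairsIn_subset
  obtain ⟨f', hf', rfl⟩ := hD hf
  rw [SimpleGraph.ConnectedComponent.mem_supp_iff] at hf'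
  exact hf' ▸ hD

lemma SquareComponent.pairwise_disjoint_pairs {Γ : SimpleGraph V} {C D : SquareComponent Γ}
    (h : C ≠ D) : Disjoint C.pairs D.pairs := by
  rw [Set.disjoint_left]
  rintro _ ⟨f, hf, rfl⟩ ⟨g, hg, hfg⟩
  obtain rfl := Subtype.ext hfg
  rw [SimpleGraph.ConnectedComponent.mem_supp_iff] at hf hg
  exact h (hf.symm.trans hg)

/-- The components with at least `s` pairs are few, since they are disjoint. -/
lemma SquareComponent.card_mul_le_choose [Finite V] {Γ : SimpleGraph V} {s : ℝ}
    (I : Finset (SquareComponent Γ)) (hI : ∀ C ∈ I, s ≤ C.size) :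
    I.card * s ≤ (Nat.card V).choose 2 := by
  classical
  cases nonempty_fintype V
  have h1 : ∑ C ∈ I, C.size ≤ (Nat.card V).choose 2 := by
    have e : ∀ C : SquareComponent Γ, C.size = (Set.toFinite C.pairs).toFinset.card := fun C =>
      Set.ncard_eq_toFinset_card _
    simp only [e]
    rw [← Finset.card_biUnion fun C _ D _ h => by
      simpa using SquareComponent.pairwise_disjoint_pairs h, Nat.card_eq_fintype_card,
      ← Sym2.card_subtype_not_diag,
      Fintype.card_subtype]
    refine Finset.card_le_card fun f hf => ?_
    simp only [Finset.mem_biUnion, Set.Finite.mem_toFinset] at hf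
    obtain ⟨C, -, ⟨f, -, rfl⟩⟩ := hf
    simpa using SimpleGraph.not_isDiag_of_mem_edgeSet _ f.2
  calc (I.card : ℝ) * s = ∑ C ∈ I, s := by simp
    _ ≤ ∑ C ∈ I, (C.size : ℝ) := Finset.sum_le_sum hI
    _ ≤ _ := by exact_mod_cast h1

/-- The pairs of a component of a square graph on a subset, as two-element finsets. -/
noncomputable def SquareComponent.pairFinset [Fintype V] [DecidableEq V] {W : Set V}
    {H : SimpleGraph W} (C : SquareComponent H) : Finset (Finset V) :=
  (Set.toFinite C.pairsIn).toFinset.image Sym2.toFinset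

variable [DecidableEq V]

lemma sym2_toFinset_injective : Function.Injective (Sym2.toFinset (α := V)) := by
  intro e e' h
  refine Sym2.ext fun x => ?_
  rw [← Sym2.mem_toFinset, h, Sym2.mem_toFinset]

variable [Fintype V]

lemma SquareComponent.mem_pairFinset {W : Set V} {H : SimpleGraph W} {C : SquareComponent H}
    {f : Finset V} : f ∈ C.pairFinset ↔ ∃ e ∈ C.pairsIn, e.toFinset = f := by
  simp [SquareComponent.pairFinset]

lemma SquareComponent.card_pairFinset {W : Set V} {H : SimpleGraph W} (C : SquareComponent H) :
    C.pairFinset.card = C.size := by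
  rw [SquareComponent.pairFinset, Finset.card_image_of_injective _ sym2_toFinset_injective,
    ← Set.ncard_eq_toFinset_card, SquareComponent.pairsIn,
    Set.ncard_image_of_injective _ (Sym2.map.injective Subtype.val_injective),
    SquareComponent.size]

lemma SquareComponent.subset_of_mem_pairFinset {W : Set V} {H : SimpleGraph W}
    {C : SquareComponent H} {X : Finset V} (hX : ∀ v, v ∈ X ↔ v ∈ W) {f : Finset V}
    (hf : f ∈ C.pairFinset) :
    f ⊆ X ∧ f.card = 2 := by
  obtain ⟨_, ⟨e, ⟨e', -, rfl⟩, rfl⟩, rfl⟩ := mem_pairFinset.1 hf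
  refine ⟨fun v hv => ?_, ?_⟩
  · rw [Sym2.mem_toFinset, Sym2.mem_map] at hv
    obtain ⟨w, -, rfl⟩ := hv
    exact (hX _).2 w.2
  · refine Sym2.card_toFinset_of_not_isDiag _ ?_
    rw [Sym2.isDiag_map Subtype.val_injective]
    exact SimpleGraph.not_isDiag_of_mem_edgeSet _ e'.2

end SquareGraph

/-! ### Janson's inequality for joining two families of pairs. -/

section CompleteBipartite

variable {V : Type*} [DecidableEq V]

lemma card_inter_le_one_of_ne {f g : Finset V} (hf : f.card = 2) (hg : g.card = 2) (h : g ≠ f) :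
    (f ∩ g).card ≤ 1 := by
  by_contra! hc
  have h1 : f ∩ g = f := Finset.eq_of_subset_of_card_le Finset.inter_subset_left (by omega)
  have h2 : f ∩ g = g := Finset.eq_of_subset_of_card_le Finset.inter_subset_right (by omega)
  exact h (h2.symm.trans h1)

lemma card_filter_mem_le_card [Fintype V] {G : Finset (Finset V)} (hG : ∀ g ∈ G, g.card = 2)
    (v : V) : (G.filter fun g => v ∈ g).card ≤ Fintype.card V := by
  refine (Finset.card_le_card (t := Finset.univ.image fun w => ({v, w} : Finset V)) ?_).trans
    Finset.card_image_le
  intro g hg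
  obtain ⟨hgG, hv⟩ := Finset.mem_filter.1 hg
  obtain ⟨x, y, -, rfl⟩ := Finset.card_eq_two.1 (hG g hgG)
  simp only [Finset.mem_insert, Finset.mem_singleton] at hv
  rw [Finset.mem_image]
  rcases hv with rfl | rfl
  · exact ⟨y, Finset.mem_univ _, rfl⟩
  · exact ⟨x, Finset.mem_univ _, Finset.pair_comm _ _⟩

lemma card_filter_not_disjoint_le {F : Finset (Finset V)} {d : ℕ}
    (hd : ∀ v, (F.filter fun f => v ∈ f).card ≤ d) {f : Finset V} (hf : f.card = 2) :
    (F.filter fun f' => ¬ Disjoint f f').card ≤ 2 * d := by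
  have : (F.filter fun f' => ¬ Disjoint f f') ⊆ f.biUnion fun v => F.filter fun f' => v ∈ f' := by
    intro f' hf'
    obtain ⟨h1, h2⟩ := Finset.mem_filter.1 hf'
    obtain ⟨v, hv, hv'⟩ := Finset.not_disjoint_iff.1 h2
    exact Finset.mem_biUnion.2 ⟨v, hv, Finset.mem_filter.2 ⟨h1, hv'⟩⟩
  rw [← hf]
  exact (Finset.card_le_card this).trans (Finset.card_biUnion_le_card_mul _ _ _ fun v _ => hd v)

/-- The union has `8 - |f ∩ f'||g ∩ g'|` elements: 4 if both pairs agree, at least 6 if exactly one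
does, at least 7 if neither does. -/
lemma pow_card_union_product_le {p : ℝ} (h0 : 0 ≤ p) (h1 : p ≤ 1) {f f' g g' : Finset V}
    (hf : f.card = 2) (hf' : f'.card = 2) (hg : g.card = 2) (hg' : g'.card = 2) :
    p ^ (f ×ˢ g ∪ f' ×ˢ g').card ≤
      (if f' = f then 1 else 0) * (if g' = g then 1 else 0) * p ^ 4 +
        (if f' = f then 1 else 0) * p ^ 6 + (if g' = g then 1 else 0) * p ^ 6 + p ^ 7 := by
  have hcard := Finset.card_union_add_card_inter (f ×ˢ g) (f' ×ˢ g')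
  rw [Finset.product_inter_product, Finset.card_product, Finset.card_product, Finset.card_product,
    hf, hf', hg, hg'] at hcard
  have p4 := pow_nonneg h0 4
  have p6 := pow_nonneg h0 6
  have p7 := pow_nonneg h0 7
  have hi2 : (f ∩ f').card ≤ 2 := hf ▸ Finset.card_le_card Finset.inter_subset_left
  have hj2 : (g ∩ g').card ≤ 2 := hg ▸ Finset.card_le_card Finset.inter_subset_left
  have main : ∀ k, k ≤ (f ×ˢ g ∪ f' ×ˢ g').card → p ^ (f ×ˢ g ∪ f' ×ˢ g').card ≤ p ^ k :=
    fun k hk => pow_le_pow_of_le_one h0 h1 hk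
  by_cases hff : f' = f
  · by_cases hgg : g' = g
    · have := main 4 (by nlinarith)
      simp only [hff, hgg, if_true] at this ⊢
      linarith
    · have hj1 := card_inter_le_one_of_ne hg hg' hgg
      have := main 6 (by nlinarith)
      simp only [hff, hgg, if_true, if_false] at this ⊢
      linarith
  · have hi1 := card_inter_le_one_of_ne hf hf' hff
    by_cases hgg : g' = g
    · have := main 6 (by nlinarith)
      simp only [hff, hgg, if_true, if_false] at this ⊢
      linarith
    · have hj1 := card_inter_le_one_of_ne hg hg' hgg
      have := main 7 (by nlinarith)
      simp only [hff, hgg, if_false] at this ⊢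
      linarith

/-- If `F` and `G` are families of pairs in `X` and `Y`, and each vertex lies in at most `d ≤ 1 / p`
pairs of `F`, then a random bipartite graph between `X` and `Y` is unlikely to contain no complete
bipartite graph between a pair of `F` and a pair of `G`. -/
theorem subsetExpect_no_complete_bipartite_le [Fintype V] {p : ℝ} (h0 : 0 < p) (h1 : p ≤ 1)
    (hn : 1 ≤ Fintype.card V * p ^ 2) {X Y : Finset V} {F G : Finset (Finset V)}
    (hF : ∀ f ∈ F, f ⊆ X ∧ f.card = 2) (hG : ∀ g ∈ G, g ⊆ Y ∧ g.card = 2) {d : ℕ}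
    (hd : ∀ v, (F.filter fun f => v ∈ f).card ≤ d) (hdp : d * p ≤ 1) :
    subsetExpect p (X ×ˢ Y) (fun T => if ∀ f ∈ F, ∀ g ∈ G, ¬ f ×ˢ g ⊆ T then 1 else 0) ≤
      Real.exp (-(F.card * G.card * p ^ 2 / (18 * Fintype.card V))) := by
  set n : ℝ := (Fintype.card V : ℝ)
  have hn0 : 0 < n := by
    by_contra! h
    nlinarith [sq_nonneg p]
  -- Janson's inequality is applied with `D > 0`, so the empty families, where the bound is 1, go
  -- first.
  by_cases hne : F.card * G.card = 0
  · have : (F.card : ℝ) * G.card = 0 := by exact_mod_cast hne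
    rw [this]
    simp only [zero_mul, zero_div, neg_zero, Real.exp_zero]
    exact subsetExpect_le_of_le h0.le h1 fun T _ => by split_ifs <;> norm_num
  have hpos : (0 : ℝ) < F.card * G.card := by exact_mod_cast Nat.pos_of_ne_zero hne
  have hcardA : ∀ i ∈ F ×ˢ G, p ^ (i.1 ×ˢ i.2).card = p ^ 4 := by
    intro i hi
    rw [Finset.mem_product] at hi
    rw [Finset.card_product, (hF _ hi.1).2, (hG _ hi.2).2]
  have key : ∀ i ∈ F ×ˢ G, ∑ j ∈ F ×ˢ G with ¬ Disjoint (i.1 ×ˢ i.2) (j.1 ×ˢ j.2),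
      p ^ (i.1 ×ˢ i.2 ∪ j.1 ×ˢ j.2).card ≤ 9 * (n * p ^ 6) := by
    rintro ⟨f, g⟩ hi
    rw [Finset.mem_product] at hi
    have hf := hi.1
    have hg := hi.2
    simp only at hf hg ⊢
    set RF := F.filter fun f' => ¬ Disjoint f f'
    set RG := G.filter fun g' => ¬ Disjoint g g'
    have hRF : (RF.card : ℝ) ≤ 2 * d := by
      exact_mod_cast card_filter_not_disjoint_le hd (hF f hf).2
    have hRG : (RG.card : ℝ) ≤ 2 * n := by
      simp only [n]
      exact_mod_cast card_filter_not_disjoint_le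
        (fun v => card_filter_mem_le_card (fun g hg => (hG g hg).2) v) (hG g hg).2
    -- Products of pairs meet only if both factors meet, so each factor has few choices: at most `2d
    -- ≤ 2/p` in `F` and `2n` in `G`.
    have hsub : ((F ×ˢ G).filter fun j => ¬ Disjoint (f ×ˢ g) (j.1 ×ˢ j.2)) ⊆ RF ×ˢ RG := by
      intro j hj
      obtain ⟨hj, hjd⟩ := Finset.mem_filter.1 hj
      rw [Finset.mem_product] at hj
      rw [Finset.disjoint_product] at hjd
      push Not at hjd
      exact Finset.mem_product.2 ⟨Finset.mem_filter.2 ⟨hj.1, hjd.1⟩,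
        Finset.mem_filter.2 ⟨hj.2, hjd.2⟩⟩
    have hfR : f ∈ RF := Finset.mem_filter.2 ⟨hf, by
      rw [disjoint_self, Finset.bot_eq_empty, ← Finset.card_eq_zero, (hF f hf).2]; norm_num⟩
    have hgR : g ∈ RG := Finset.mem_filter.2 ⟨hg, by
      rw [disjoint_self, Finset.bot_eq_empty, ← Finset.card_eq_zero, (hG g hg).2]; norm_num⟩
    calc _ ≤ ∑ j ∈ RF ×ˢ RG, p ^ (f ×ˢ g ∪ j.1 ×ˢ j.2).card :=
          Finset.sum_le_sum_of_subset_of_nonneg hsub fun _ _ _ => pow_nonneg h0.le _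
      _ ≤ ∑ j ∈ RF ×ˢ RG, ((if j.1 = f then 1 else 0) * (if j.2 = g then 1 else 0) * p ^ 4 +
        (if j.1 = f then 1 else 0) * p ^ 6 + (if j.2 = g then 1 else 0) * p ^ 6 + p ^ 7) := by
          refine Finset.sum_le_sum fun j hj => ?_
          rw [Finset.mem_product] at hj
          exact pow_card_union_product_le h0.le h1 (hF f hf).2
            (hF _ (Finset.mem_filter.1 hj.1).1).2 (hG g hg).2
            (hG _ (Finset.mem_filter.1 hj.2).1).2
      _ = p ^ 4 + RG.card * p ^ 6 + RF.card * p ^ 6 + RF.card * RG.card * p ^ 7 := by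
          rw [Finset.sum_product]
          simp [Finset.sum_add_distrib, Finset.sum_ite_irrel, ite_mul, hfR, hgR]
          ring
      -- With `np² ≥ 1` the four terms are at most 1, 2, 2 and 4 times `np⁶`.
      _ ≤ 9 * (n * p ^ 6) := by
          have q4 : p ^ 4 ≤ n * p ^ 6 := by nlinarith [pow_pos h0 4]
          have q6 : RG.card * p ^ 6 ≤ 2 * (n * p ^ 6) := by nlinarith [pow_pos h0 6]
          have q5 : p ^ 5 ≤ p ^ 4 := pow_le_pow_of_le_one h0.le h1 (by norm_num)
          have q6' : RF.card * p ^ 6 ≤ 2 * p ^ 5 := by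
            have : RF.card * p ≤ 2 := by nlinarith
            nlinarith [pow_pos h0 5]
          have q7 : RF.card * RG.card * p ^ 7 ≤ 4 * (n * p ^ 6) := by
            have e1 : RF.card * p ≤ 2 := by nlinarith
            have e2 : (RF.card * p) * RG.card ≤ 2 * (2 * n) :=
              mul_le_mul e1 hRG (Nat.cast_nonneg _) (by norm_num)
            nlinarith [pow_pos h0 6]
          linarith
  have hD : 0 < F.card * G.card * (9 * (n * p ^ 6)) := by positivity
  have := janson_inequality h0.le h1 (X ×ˢ Y) (F ×ˢ G) (fun i => i.1 ×ˢ i.2)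
    (fun i hi => by
      rw [Finset.mem_product] at hi
      exact Finset.product_subset_product (hF _ hi.1).1 (hG _ hi.2).1)
    (μ := F.card * G.card * p ^ 4) (D := F.card * G.card * (9 * (n * p ^ 6)))
    (by positivity) hD
    (by rw [Finset.sum_congr rfl hcardA, Finset.sum_const, Finset.card_product]; simp)
    ((Finset.sum_le_sum key).trans
      (by rw [Finset.sum_const, Finset.card_product]; simp))
  have e : (F.card * G.card * p ^ 4) ^ 2 / (2 * (F.card * G.card * (9 * (n * p ^ 6)))) =
      F.card * G.card * p ^ 2 / (18 * n) := by
    field_simp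
    ring
  rw [e] at this
  refine le_trans (subsetExpect_mono h0.le h1 fun T _ => ?_) this
  simp only [Finset.mem_product, and_imp, Prod.forall]
  refine le_of_eq (if_congr ?_ rfl rfl)
  exact ⟨fun h a b ha hb => h a ha b hb, fun h a ha b hb => h a b ha hb⟩

end CompleteBipartite

/-! ### The binomial random graph conditioned on an induced subgraph. -/

section BinomialRandom

variable {V : Type*}

lemma induce_fromEdgeSet_congr {W : Set V} {S T : Set (Sym2 V)}
    (h : ∀ a ∈ W, ∀ b ∈ W, s(a, b) ∈ S ↔ s(a, b) ∈ T) :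
    (SimpleGraph.fromEdgeSet S).induce W = (SimpleGraph.fromEdgeSet T).induce W := by
  ext a b
  simp [h a a.2 b b.2]

/-- For finite `V` this makes every event measurable. -/
instance SimpleGraph.measurableSingletonClass [Countable V] :
    MeasurableSingletonClass (SimpleGraph V) := by
  refine ⟨fun Γ => ?_⟩
  have : ({Γ} : Set (SimpleGraph V)) = SimpleGraph.Adj ⁻¹' {Γ.Adj} := by
    ext Γ'
    simp [SimpleGraph.adj_inj]
  rw [this]
  exact SimpleGraph.measurable_adj (measurableSet_singleton _)

/-- Each single graph has positive mass when `0 < p < 1`. Hence conditioning on `Γ[W₂] = H` gives a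
genuine probability measure, which is needed to pass to complements. -/
lemma binomialRandom_ne_zero [Finite V] {p : unitInterval} (h0 : 0 < (p : ℝ)) (h1 : (p : ℝ) < 1)
    {A : Set (SimpleGraph V)} (hA : A.Nonempty) : SimpleGraph.binomialRandom V p A ≠ 0 := by
  obtain ⟨Γ, hΓ⟩ := hA
  refine fun h => absurd (MeasureTheory.measure_mono_null (Set.singleton_subset_iff.2 hΓ) h) ?_
  have a : unitInterval.toNNReal p ≠ 0 := fun h => h0.ne' (congrArg NNReal.toReal h)
  have b : unitInterval.toNNReal (unitInterval.symm p) ≠ 0 := fun h => by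
    have : (1 - p : ℝ) = 0 := congrArg NNReal.toReal h
    linarith
  rw [SimpleGraph.binomialRandom_singleton]
  exact mul_ne_zero (pow_ne_zero _ (by exact_mod_cast a)) (pow_ne_zero _ (by exact_mod_cast b))

variable [DecidableEq V]

/-- The unordered pairs of distinct elements of `X`. -/
def pairsWithin (X : Finset V) : Finset (Sym2 V) := X.offDiag.image Sym2.mk.uncurry

lemma mk_mem_pairsWithin {X : Finset V} {a b : V} :
    s(a, b) ∈ pairsWithin X ↔ a ∈ X ∧ b ∈ X ∧ a ≠ b := by
  simp only [pairsWithin, Finset.mem_image, Finset.mem_offDiag, Prod.exists,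
    Function.uncurry_apply_pair, Sym2.eq_iff]
  constructor
  · rintro ⟨x, y, ⟨hx, hy, hxy⟩, ⟨rfl, rfl⟩ | ⟨rfl, rfl⟩⟩
    exacts [⟨hx, hy, hxy⟩, ⟨hy, hx, hxy.symm⟩]
  · exact fun h => ⟨a, b, h, Or.inl ⟨rfl, rfl⟩⟩

lemma card_pairsWithin (X : Finset V) : (pairsWithin X).card = X.card.choose 2 :=
  Sym2.card_image_offDiag X

variable [Fintype V]

/-- The probability of an event in the binomial random graph as a finite sum over edge sets. -/
lemma binomialRandom_real_eq_subsetExpect (p : unitInterval) (B : Set (SimpleGraph V))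
    [DecidablePred (· ∈ B)] :
    (SimpleGraph.binomialRandom V p).real B = subsetExpect (p : ℝ) (pairsWithin Finset.univ)
      (fun S : Finset (Sym2 V) =>
        if SimpleGraph.fromEdgeSet (S : Set (Sym2 V)) ∈ B then 1 else 0) := by
  classical
  have hB : B = ((Set.toFinite B).toFinset : Set (SimpleGraph V)) := by simp
  conv_lhs => rw [hB]
  rw [← MeasureTheory.sum_measureReal_singleton, subsetExpect]
  simp only [mul_ite, mul_one, mul_zero]
  rw [← Finset.sum_filter]
  have hnd : ∀ e : Sym2 V, e ∈ pairsWithin Finset.univ ↔ ¬ e.IsDiag := by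
    intro e
    induction e using Sym2.ind with
    | _ a b => simp [mk_mem_pairsWithin]
  have hcoe : ∀ S ⊆ pairsWithin (Finset.univ : Finset V),
      (SimpleGraph.fromEdgeSet (S : Set (Sym2 V))).edgeSet = S := by
    intro S hS
    rw [SimpleGraph.edgeSet_fromEdgeSet, sdiff_eq_left, Set.disjoint_left]
    exact fun e he => (hnd e).1 (hS he)
  refine Finset.sum_nbij' (fun Γ => (Set.toFinite Γ.edgeSet).toFinset)
    (fun S => SimpleGraph.fromEdgeSet (S : Set (Sym2 V))) ?_ ?_ ?_ ?_ ?_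
  · intro Γ hΓ
    simp only [Set.Finite.mem_toFinset] at hΓ
    rw [Finset.mem_filter, Finset.mem_powerset]
    refine ⟨fun e he => (hnd e).2 ?_, ?_⟩
    · exact SimpleGraph.not_isDiag_of_mem_edgeSet _ ((Set.Finite.mem_toFinset _).1 he)
    · simpa using hΓ
  · intro S hS
    simpa using (Finset.mem_filter.1 hS).2
  · intro Γ _
    simp
  · intro S hS
    rw [Finset.mem_filter, Finset.mem_powerset] at hS
    ext e
    rw [Set.Finite.mem_toFinset, hcoe S hS.1, Finset.mem_coe]
  · intro Γ _
    rw [MeasureTheory.measureReal_def, SimpleGraph.binomialRandom_singleton, card_pairsWithin,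
      ← Set.ncard_eq_toFinset_card, Finset.card_univ, Nat.card_eq_fintype_card]
    simp

/-- To bound the conditional probability of an event given the subgraph induced on `W₂`, it suffices
to expose the independent edges inside `W₁` and between `W₁` and `W₂`. -/
theorem cond_binomialRandom_real_le {p : unitInterval} {W₁ W₂ : Set V} (hW : IsCompl W₁ W₂)
    {X Y : Finset V} (hX : ∀ v, v ∈ X ↔ v ∈ W₁) (hY : ∀ v, v ∈ Y ↔ v ∈ W₂) {H : SimpleGraph W₂}
    {B : Set (SimpleGraph V)} {q : ℝ} (b : SimpleGraph W₁ → Finset (V × V) → ℝ)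
    (hb0 : ∀ G T, 0 ≤ b G T)
    (hb : ∀ (Γ : SimpleGraph V) (T : Finset (V × V)), Γ.induce W₂ = H →
      (∀ x ∈ T, Γ.Adj x.1 x.2) → Γ ∈ B → 1 ≤ b (Γ.induce W₁) T)
    (hq : subsetExpect (p : ℝ) (pairsWithin X) (fun S => subsetExpect (p : ℝ) (X ×ˢ Y)
      (b ((SimpleGraph.fromEdgeSet (S : Set (Sym2 V))).induce W₁))) ≤ q) :
    (cond (SimpleGraph.binomialRandom V p) {Γ : SimpleGraph V | Γ.induce W₂ = H}).real B ≤ q := by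
  classical
  have p0 := p.2.1
  have p1 := p.2.2
  have hXY : Disjoint X Y := by
    rw [Finset.disjoint_left]
    intro v hv hv'
    exact Set.disjoint_left.1 hW.disjoint ((hX v).1 hv) ((hY v).1 hv')
  have hXY' : ∀ v ∈ X, v ∉ Y := fun v hv => Finset.disjoint_left.1 hXY hv
  have hcov : ∀ v, v ∈ X ∨ v ∈ Y := by
    intro v
    rw [hX, hY]
    exact (Set.ext_iff.1 hW.sup_eq_top v).2 trivial
  set A : Set (SimpleGraph V) := {Γ | Γ.induce W₂ = H}
  set μ := SimpleGraph.binomialRandom V p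
  have hinj : Set.InjOn (Sym2.mk.uncurry : V × V → Sym2 V) (X ×ˢ Y : Finset (V × V)) := by
    rintro ⟨a, x⟩ h ⟨a', x'⟩ h' he
    simp only [Finset.coe_product, Set.mem_prod, Finset.mem_coe] at h h'
    simp only [Function.uncurry_apply_pair, Sym2.eq_iff] at he
    rcases he with ⟨rfl, rfl⟩ | ⟨rfl, rfl⟩
    · rfl
    · exact absurd h'.2 (hXY' _ h.1)
  have hd1 : Disjoint (pairsWithin X) ((X ×ˢ Y).image Sym2.mk.uncurry) := by
    rw [Finset.disjoint_left]
    intro e he he'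
    obtain ⟨⟨a, x⟩, hax, rfl⟩ := Finset.mem_image.1 he'
    rw [Finset.mem_product] at hax
    exact hXY' _ (mk_mem_pairsWithin.1 he).2.1 hax.2
  have hd2 : Disjoint (pairsWithin Y) (pairsWithin X ∪ (X ×ˢ Y).image Sym2.mk.uncurry) := by
    rw [Finset.disjoint_left]
    intro e he he'
    rcases Finset.mem_union.1 he' with he' | he'
    · induction e using Sym2.ind with
      | _ a b => exact hXY' _ (mk_mem_pairsWithin.1 he').1 (mk_mem_pairsWithin.1 he).1
    · obtain ⟨⟨a, x⟩, hax, rfl⟩ := Finset.mem_image.1 he'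
      rw [Finset.mem_product] at hax
      exact hXY' _ hax.1 (mk_mem_pairsWithin.1 he).1
  -- Edges split into those inside `W₂`, inside `W₁`, and across.
  have hU : pairsWithin (Finset.univ : Finset V) =
      pairsWithin Y ∪ (pairsWithin X ∪ (X ×ˢ Y).image Sym2.mk.uncurry) := by
    ext e
    induction e using Sym2.ind with
    | _ a b =>
      simp only [Finset.mem_union, mk_mem_pairsWithin, Finset.mem_univ, true_and,
        Finset.mem_image, Finset.mem_product, Prod.exists, Function.uncurry_apply_pair,
        Sym2.eq_iff]
      constructor
      · intro hab
        rcases hcov a with ha | ha <;> rcases hcov b with hb | hb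
        · exact Or.inr (Or.inl ⟨ha, hb, hab⟩)
        · exact Or.inr (Or.inr ⟨a, b, ⟨ha, hb⟩, Or.inl ⟨rfl, rfl⟩⟩)
        · exact Or.inr (Or.inr ⟨b, a, ⟨hb, ha⟩, Or.inr ⟨rfl, rfl⟩⟩)
        · exact Or.inl ⟨ha, hb, hab⟩
      · rintro (h | h | ⟨x, y, ⟨hx, hy⟩, ⟨rfl, rfl⟩ | ⟨rfl, rfl⟩⟩)
        · exact h.2.2
        · exact h.2.2
        · rintro rfl
          exact hXY' _ hx hy
        · rintro rfl
          exact hXY' _ hx hy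
  have hexp : ∀ B' : Set (SimpleGraph V), μ.real B' = subsetExpect (p : ℝ) (pairsWithin Y)
      (fun O => subsetExpect (p : ℝ) (pairsWithin X) (fun S => subsetExpect (p : ℝ) (X ×ˢ Y)
        (fun T => if SimpleGraph.fromEdgeSet
          ((O ∪ (S ∪ T.image Sym2.mk.uncurry) : Finset (Sym2 V)) : Set (Sym2 V)) ∈ B'
          then 1 else 0))) := by
    intro B'
    rw [binomialRandom_real_eq_subsetExpect, hU, subsetExpect_union _ hd2]
    refine subsetExpect_congr fun O _ => ?_
    rw [subsetExpect_union _ hd1]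
    refine subsetExpect_congr fun S _ => ?_
    rw [subsetExpect_image _ _ hinj]
  have hW2 : ∀ O ⊆ pairsWithin Y, ∀ S ⊆ pairsWithin X, ∀ T ⊆ X ×ˢ Y,
      (SimpleGraph.fromEdgeSet ((O ∪ (S ∪ T.image Sym2.mk.uncurry) : Finset (Sym2 V)) :
        Set (Sym2 V))).induce W₂ = (SimpleGraph.fromEdgeSet (O : Set (Sym2 V))).induce W₂ := by
    intro O hO S hS T hT
    refine induce_fromEdgeSet_congr fun a ha b hb => ?_
    rw [← hY] at ha hb
    simp only [Finset.mem_coe, Finset.mem_union, or_iff_left_iff_imp]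
    rintro (h | h)
    · exact absurd ha (hXY' _ (mk_mem_pairsWithin.1 (hS h)).1)
    · obtain ⟨⟨x, y⟩, hxy, he⟩ := Finset.mem_image.1 h
      have hx := (Finset.mem_product.1 (hT hxy)).1
      rw [Function.uncurry_apply_pair, Sym2.eq_iff] at he
      rcases he with ⟨rfl, rfl⟩ | ⟨rfl, rfl⟩
      · exact absurd ha (hXY' _ hx)
      · exact absurd hb (hXY' _ hx)
  have hW1 : ∀ O ⊆ pairsWithin Y, ∀ S ⊆ pairsWithin X, ∀ T ⊆ X ×ˢ Y,
      (SimpleGraph.fromEdgeSet ((O ∪ (S ∪ T.image Sym2.mk.uncurry) : Finset (Sym2 V)) :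
        Set (Sym2 V))).induce W₁ = (SimpleGraph.fromEdgeSet (S : Set (Sym2 V))).induce W₁ := by
    intro O hO S hS T hT
    refine induce_fromEdgeSet_congr fun a ha b hb => ?_
    rw [← hX] at ha hb
    simp only [Finset.mem_coe, Finset.mem_union]
    constructor
    · rintro (h | h | h)
      · exact absurd (mk_mem_pairsWithin.1 (hO h)).1 (hXY' _ ha)
      · exact h
      · obtain ⟨⟨x, y⟩, hxy, he⟩ := Finset.mem_image.1 h
        have hy := (Finset.mem_product.1 (hT hxy)).2
        rw [Function.uncurry_apply_pair, Sym2.eq_iff] at he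
        rcases he with ⟨rfl, rfl⟩ | ⟨rfl, rfl⟩
        · exact absurd hy (hXY' _ hb)
        · exact absurd hy (hXY' _ ha)
    · exact fun h => Or.inr (Or.inl h)
  -- The conditioning event depends only on the edges `O` inside `W₂`, so the inequality is checked
  -- for each `O` separately.
  have hAB : μ.real (A ∩ B) ≤ q * μ.real A := by
    rw [hexp, hexp, ← subsetExpect_mul_left]
    refine subsetExpect_mono p0 p1 fun O hO => ?_
    by_cases hOH : (SimpleGraph.fromEdgeSet (O : Set (Sym2 V))).induce W₂ = H
    · have e1 : subsetExpect (p : ℝ) (pairsWithin X) (fun S => subsetExpect (p : ℝ) (X ×ˢ Y)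
          (fun T => if SimpleGraph.fromEdgeSet
            ((O ∪ (S ∪ T.image Sym2.mk.uncurry) : Finset (Sym2 V)) : Set (Sym2 V)) ∈ A
            then 1 else 0)) = 1 := by
        refine (subsetExpect_congr fun S hS => ?_).trans (subsetExpect_const _ _ 1)
        refine (subsetExpect_congr fun T hT => ?_).trans (subsetExpect_const _ _ 1)
        exact if_pos ((hW2 O hO S hS T hT).trans hOH)
      rw [e1, mul_one]
      refine le_trans (subsetExpect_mono p0 p1 fun S hS =>
        subsetExpect_mono p0 p1 fun T hT => ?_) hq
      split_ifs with h
      · rw [← hW1 O hO S hS T hT]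
        refine hb _ T h.1 (fun x hx => ?_) h.2
        rw [SimpleGraph.fromEdgeSet_adj]
        have hx' := Finset.mem_product.1 (hT hx)
        refine ⟨?_, fun h => hXY' _ hx'.1 (h ▸ hx'.2)⟩
        rw [Finset.mem_coe, Finset.mem_union, Finset.mem_union, Finset.mem_image]
        exact Or.inr (Or.inr ⟨x, hx, rfl⟩)
      · exact hb0 _ _
    · have e0 : ∀ B' ⊆ A, subsetExpect (p : ℝ) (pairsWithin X) (fun S =>
          subsetExpect (p : ℝ) (X ×ˢ Y) (fun T => if SimpleGraph.fromEdgeSet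
            ((O ∪ (S ∪ T.image Sym2.mk.uncurry) : Finset (Sym2 V)) : Set (Sym2 V)) ∈ B'
            then 1 else 0)) = 0 := by
        intro B' hB'
        refine (subsetExpect_congr fun S hS => ?_).trans (subsetExpect_const _ _ 0)
        refine (subsetExpect_congr fun T hT => ?_).trans (subsetExpect_const _ _ 0)
        exact if_neg fun h => hOH ((hW2 O hO S hS T hT).symm.trans (hB' h))
      rw [e0 _ Set.inter_subset_left, e0 _ subset_rfl, mul_zero]
  have hq0 : 0 ≤ q := le_trans (subsetExpect_nonneg p0 p1 fun S _ =>
    subsetExpect_nonneg p0 p1 fun T _ => hb0 _ _) hq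
  rw [MeasureTheory.measureReal_def, cond_apply (Set.toFinite A).measurableSet,
    ENNReal.toReal_mul, ENNReal.toReal_inv, ← MeasureTheory.measureReal_def,
    ← MeasureTheory.measureReal_def]
  -- In the null case the conditional measure has real value 0, and `q ≥ 0`.
  by_cases hA0 : μ.real A = 0
  · rw [hA0, inv_zero, zero_mul]
    exact hq0
  · have hApos : 0 < μ.real A := lt_of_le_of_ne MeasureTheory.measureReal_nonneg (Ne.symm hA0)
    rw [inv_mul_le_iff₀ hApos]
    linarith

end BinomialRandom

/-! ### Joining components across, and tools for a common neighbour. -/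

section Joining

variable {V : Type*} [DecidableEq V]

lemma adj_of_product_subset {Γ : SimpleGraph V} {T : Finset (V × V)}
    (hT : ∀ x ∈ T, Γ.Adj x.1 x.2) {f g : Sym2 V} (h : f.toFinset ×ˢ g.toFinset ⊆ T) :
    ∀ a ∈ f, ∀ x ∈ g, Γ.Adj a x := fun a ha x hx =>
  hT (a, x) (h (Finset.mem_product.2 ⟨Sym2.mem_toFinset.2 ha, Sym2.mem_toFinset.2 hx⟩))

variable [Fintype V]

/-- Inserting `|G| ≥ cn²` cancels the `n` in the denominator of the exponent. -/
lemma SquareComponent.subsetExpect_no_complete_bipartite_le {p c : ℝ} (h0 : 0 < p) (h1 : p ≤ 1)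
    (hn : 1 ≤ Fintype.card V * p ^ 2) {X Y : Finset V} {W : Set V} (hY : ∀ v, v ∈ Y ↔ v ∈ W)
    {H : SimpleGraph W} {C : SquareComponent H} (hC : c * (Fintype.card V : ℝ) ^ 2 ≤ C.size)
    {F : Finset (Finset V)} (hF : ∀ f ∈ F, f ⊆ X ∧ f.card = 2) {d : ℕ}
    (hd : ∀ v, (F.filter fun f => v ∈ f).card ≤ d) (hdp : d * p ≤ 1) :
    subsetExpect p (X ×ˢ Y)
        (fun T => if ∀ f ∈ F, ∀ g ∈ C.pairFinset, ¬ f ×ˢ g ⊆ T then 1 else 0) ≤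
      Real.exp (-(c / 18 * (F.card * (Fintype.card V * p ^ 2)))) := by
  refine (_root_.subsetExpect_no_complete_bipartite_le h0 h1 hn hF
    (fun g hg => SquareComponent.subset_of_mem_pairFinset hY hg) hd hdp).trans ?_
  rw [Real.exp_le_exp, neg_le_neg_iff, C.card_pairFinset]
  have hn0 : (0 : ℝ) < Fintype.card V := by
    by_contra! h
    nlinarith [sq_nonneg p]
  rw [le_div_iff₀ (by positivity)]
  have := mul_le_mul_of_nonneg_left hC (by positivity : (0 : ℝ) ≤ F.card * p ^ 2)
  nlinarith

/-- A square component on `W₂` with many pairs absorbs all square components on `W₁` with at least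
`M` pairs, except with small probability. -/
theorem cond_exists_not_inSameSquareComponent_le {p : unitInterval} {c M : ℝ}
    (h0 : 0 < (p : ℝ)) (hn : 1 ≤ Fintype.card V * (p : ℝ) ^ 2) (hc : 0 < c) (hM : 0 < M)
    (hMp : (M + 1) * p ≤ 1) {W₁ W₂ : Set V} (hW : IsCompl W₁ W₂)
    (hW₁ : (W₁.ncard.choose 2 : ℝ) ≤ (Fintype.card V : ℝ) ^ 2 / M ^ 2) {H : SimpleGraph W₂}
    (C₂ : SquareComponent H) (hC₂ : c * (Fintype.card V : ℝ) ^ 2 ≤ C₂.size) :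
    (cond (SimpleGraph.binomialRandom V p) {Γ : SimpleGraph V | Γ.induce W₂ = H}).real
        {Γ : SimpleGraph V | ∃ C₁ : SquareComponent (Γ.induce W₁),
          M ≤ C₁.size ∧ ¬ InSameSquareComponent Γ C₁.pairsIn C₂.pairsIn} ≤
      (Fintype.card V : ℝ) ^ 2 / M ^ 3 *
        Real.exp (-(c / 18 * (M * (Fintype.card V * (p : ℝ) ^ 2)))) := by
  classical
  have h1 : (p : ℝ) ≤ 1 := p.2.2
  have hX : ∀ v, v ∈ W₁.toFinset ↔ v ∈ W₁ := fun v => Set.mem_toFinset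
  have hY : ∀ v, v ∈ W₂.toFinset ↔ v ∈ W₂ := fun v => Set.mem_toFinset
  -- The bounding function counts the large components on `W₁` with no pair joined to `C₂`: a union
  -- bound.
  refine cond_binomialRandom_real_le hW hX hY
    (fun G T => ∑ C₁ ∈ (Set.toFinite {C : SquareComponent G | M ≤ C.size}).toFinset,
      if ∀ f ∈ C₁.pairFinset, ∀ g ∈ C₂.pairFinset, ¬ f ×ˢ g ⊆ T then 1 else 0) ?_ ?_ ?_
  · exact fun G T => Finset.sum_nonneg fun C _ => by split_ifs <;> norm_num
  · rintro Γ T hΓ hT ⟨C₁, hC₁, hnot⟩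
    refine le_trans (le_of_eq (if_pos ?_).symm) (Finset.single_le_sum
      (f := fun C₁ : SquareComponent (Γ.induce W₁) =>
        if ∀ f ∈ C₁.pairFinset, ∀ g ∈ C₂.pairFinset, ¬ f ×ˢ g ⊆ T then (1 : ℝ) else 0)
      (fun C _ => by split_ifs <;> norm_num) (a := C₁) (by simpa using hC₁))
    intro f hf g hg hfg
    obtain ⟨e, he, rfl⟩ := SquareComponent.mem_pairFinset.1 hf
    obtain ⟨e', he', rfl⟩ := SquareComponent.mem_pairFinset.1 hg
    exact hnot (inSameSquareComponent_of_complete rfl hΓ he he' (adj_of_product_subset hT hfg))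
  · refine subsetExpect_le_of_le h0.le h1 fun S _ => ?_
    set G := (SimpleGraph.fromEdgeSet (S : Set (Sym2 V))).induce W₁
    set I := (Set.toFinite {C : SquareComponent G | M ≤ C.size}).toFinset
    rw [subsetExpect_sum]
    have hI : ∀ C ∈ I, M ≤ C.size := fun C hC => by simpa [I] using hC
    have hcard : (I.card : ℝ) ≤ (Fintype.card V : ℝ) ^ 2 / M ^ 3 := by
      have := SquareComponent.card_mul_le_choose I hI
      rw [Nat.card_coe_set_eq] at this
      rw [le_div_iff₀ (by positivity)]
      rw [le_div_iff₀ (by positivity)] at hW₁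
      nlinarith [mul_le_mul_of_nonneg_right this (sq_nonneg M)]
    refine (Finset.sum_le_card_nsmul I _
      (Real.exp (-(c / 18 * (M * (Fintype.card V * (p : ℝ) ^ 2))))) fun C hC => ?_).trans ?_
    · obtain ⟨F, hFC, hFcard⟩ := Finset.exists_subset_card_eq (s := C.pairFinset) (n := ⌈M⌉₊)
        (by rw [C.card_pairFinset]; exact Nat.ceil_le.2 (hI C hC))
      have hF : ∀ f ∈ F, f ⊆ W₁.toFinset ∧ f.card = 2 := fun f hf =>
        SquareComponent.subset_of_mem_pairFinset hX (hFC hf)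
      have hFM : M ≤ F.card := by rw [hFcard]; exact Nat.le_ceil M
      have hFM' : (F.card : ℝ) ≤ M + 1 := by rw [hFcard]; exact (Nat.ceil_lt_add_one hM.le).le
      refine (subsetExpect_mono h0.le h1 fun T _ => ?_).trans
        ((SquareComponent.subsetExpect_no_complete_bipartite_le h0 h1 hn hY hC₂ hF (d := F.card)
          (fun v => Finset.card_filter_le _ _) (by nlinarith)).trans ?_)
      · split_ifs with h h'
        · exact le_rfl
        · exact absurd (fun f hf => h f (hFC hf)) h'
        · exact zero_le_one
        · exact le_rfl
      · rw [Real.exp_le_exp, neg_le_neg_iff]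
        gcongr
    · rw [nsmul_eq_mul]
      gcongr

/-- Every family of pairs contains a large subfamily of bounded degree. -/
lemma exists_subset_card_filter_mem_le {X : Finset V} {Q : Finset (Finset V)}
    (hQ : ∀ f ∈ Q, f ⊆ X ∧ f.card = 2) (d : ℕ) :
    ∃ F ⊆ Q, (∀ v, (F.filter fun f => v ∈ f).card ≤ d) ∧
      d * Q.card ≤ F.card * (d + 2 * X.card) := by
  obtain ⟨F, hF, hmax⟩ := Finset.exists_max_image
    (Q.powerset.filter fun F => ∀ v, (F.filter fun f => v ∈ f).card ≤ d) Finset.card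
    ⟨∅, by simp⟩
  rw [Finset.mem_filter, Finset.mem_powerset] at hF
  obtain ⟨hFQ, hFd⟩ := hF
  refine ⟨F, hFQ, hFd, ?_⟩
  -- The saturated vertices. By maximality of `F`, every pair of `Q` outside `F` contains one, while
  -- counting degrees shows that they are few.
  set Z := X.filter fun v => d ≤ (F.filter fun f => v ∈ f).card
  have hcover : Q \ F ⊆ Z.biUnion fun v => X.image fun w => {v, w} := by
    intro f hf
    rw [Finset.mem_sdiff] at hf
    obtain ⟨hfX, hf2⟩ := hQ f hf.1
    have hex : ∃ v ∈ f, d ≤ (F.filter fun f => v ∈ f).card := by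
      by_contra! hcon
      have hmem : insert f F ∈
          Q.powerset.filter fun F => ∀ v, (F.filter fun f => v ∈ f).card ≤ d := by
        rw [Finset.mem_filter, Finset.mem_powerset]
        refine ⟨Finset.insert_subset hf.1 hFQ, fun v => ?_⟩
        rw [Finset.filter_insert]
        split_ifs with hv
        · exact (Finset.card_insert_le _ _).trans (hcon v hv)
        · exact hFd v
      have := hmax _ hmem
      rw [Finset.card_insert_of_notMem hf.2] at this
      omega
    obtain ⟨v, hv, hvd⟩ := hex
    rw [Finset.mem_biUnion]
    refine ⟨v, Finset.mem_filter.2 ⟨hfX hv, hvd⟩, ?_⟩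
    rw [Finset.mem_image]
    obtain ⟨x, y, -, rfl⟩ := Finset.card_eq_two.1 hf2
    rcases Finset.mem_insert.1 hv with rfl | hv
    · exact ⟨y, hfX (by simp), rfl⟩
    · rw [Finset.mem_singleton] at hv
      subst hv
      exact ⟨x, hfX (by simp), Finset.pair_comm _ _⟩
  have hZ : d * Z.card ≤ 2 * F.card := by
    have e : ∑ v ∈ X, (F.filter fun f => v ∈ f).card = ∑ f ∈ F, f.card := by
      simp only [Finset.card_filter]
      rw [Finset.sum_comm]
      refine Finset.sum_congr rfl fun f hf => ?_
      rw [← Finset.card_filter, Finset.filter_mem_eq_inter,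
        Finset.inter_eq_right.2 (hQ f (hFQ hf)).1]
    have e2 : ∑ f ∈ F, f.card = 2 * F.card := by
      rw [Finset.sum_congr rfl fun f hf => (hQ f (hFQ hf)).2, Finset.sum_const, smul_eq_mul,
        mul_comm]
    rw [← e2, ← e, mul_comm, ← smul_eq_mul]
    exact (Finset.card_nsmul_le_sum Z _ d fun v hv => (Finset.mem_filter.1 hv).2).trans
      (Finset.sum_le_sum_of_subset (Finset.filter_subset _ _))
  have hcard : Q.card ≤ F.card + Z.card * X.card := by
    rw [← Finset.card_sdiff_add_card_eq_card hFQ, add_comm]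
    gcongr
    exact (Finset.card_le_card hcover).trans
      (Finset.card_biUnion_le_card_mul _ _ _ fun v _ => Finset.card_image_le)
  nlinarith [Nat.mul_le_mul_left d hcard, Nat.mul_le_mul_right X.card hZ]

/-- A sparse random subset rarely has more than half of the elements. -/
lemma subsetExpect_half_le {α : Type*} {p : ℝ} (h0 : 0 ≤ p) (hp : p ≤ 1 / 12) (U : Finset α) :
    subsetExpect p U (fun S => if U.card < 2 * S.card then 1 else 0) ≤
      Real.exp (-(U.card / 2)) := by
  -- Since `p ≤ 1/12 < 1/(4e)`, the factor `p^|S|` with `|S| > |U|/2` pays for all `2^|U|` subsets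
  -- and leaves `exp(-|U|/2)`.
  have hterm : ∀ S ∈ U.powerset, p ^ S.card * (1 - p) ^ (U.card - S.card) *
      (if U.card < 2 * S.card then 1 else 0) ≤ (2 ^ U.card)⁻¹ * Real.exp (-(U.card / 2)) := by
    intro S _
    split_ifs with h
    · have e1 : (1 - p) ^ (U.card - S.card) ≤ 1 := pow_le_one₀ (by linarith) (by linarith)
      have e2 : p ^ S.card ≤ ((4 : ℝ) ^ S.card)⁻¹ * Real.exp (-(S.card : ℝ)) := by
        have : p ≤ 4⁻¹ * Real.exp (-1) := by
          have := Real.exp_neg_one_gt_d9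
          linarith
        calc p ^ S.card ≤ (4⁻¹ * Real.exp (-1)) ^ S.card := pow_le_pow_left₀ h0 this _
          _ = _ := by rw [mul_pow, ← Real.exp_nat_mul, inv_pow]; ring_nf
      have e3 : ((4 : ℝ) ^ S.card)⁻¹ ≤ (2 ^ U.card)⁻¹ := by
        rw [show (4 : ℝ) = 2 ^ 2 by norm_num, ← pow_mul]
        gcongr
        · norm_num
      have e4 : Real.exp (-(S.card : ℝ)) ≤ Real.exp (-(U.card / 2)) := by
        rw [Real.exp_le_exp]
        have : (U.card : ℝ) ≤ 2 * S.card := by exact_mod_cast h.le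
        linarith
      rw [mul_one]
      calc _ ≤ p ^ S.card * 1 := by gcongr
        _ ≤ _ := by
          rw [mul_one]
          refine e2.trans ?_
          gcongr
    · rw [mul_zero]
      positivity
  refine (Finset.sum_le_sum hterm).trans ?_
  rw [Finset.sum_const, Finset.card_powerset, nsmul_eq_mul]
  push_cast
  rw [mul_inv_cancel_left₀ (by positivity)]

/-- The non-edges of a graph on a subset, as two-element finsets. -/
noncomputable def nonEdgePairs {W : Set V} (G : SimpleGraph W) : Finset (Finset V) :=
  (Set.toFinite Gᶜ.edgeSet).toFinset.image fun e => (Sym2.map Subtype.val e).toFinset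

lemma mem_nonEdgePairs {W : Set V} {G : SimpleGraph W} {f : Finset V} :
    f ∈ nonEdgePairs G ↔ ∃ e ∈ Gᶜ.edgeSet, (Sym2.map Subtype.val e).toFinset = f := by
  simp [nonEdgePairs]

lemma subset_of_mem_nonEdgePairs {W : Set V} {G : SimpleGraph W} {X : Finset V}
    (hX : ∀ v, v ∈ X ↔ v ∈ W) {f : Finset V} (hf : f ∈ nonEdgePairs G) :
    f ⊆ X ∧ f.card = 2 := by
  obtain ⟨e, he, rfl⟩ := mem_nonEdgePairs.1 hf
  refine ⟨fun v hv => ?_, ?_⟩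
  · rw [Sym2.mem_toFinset, Sym2.mem_map] at hv
    obtain ⟨w, -, rfl⟩ := hv
    exact (hX _).2 w.2
  · refine Sym2.card_toFinset_of_not_isDiag _ ?_
    rw [Sym2.isDiag_map Subtype.val_injective]
    exact SimpleGraph.not_isDiag_of_mem_edgeSet _ he

lemma card_sub_card_le_card_nonEdgePairs {W : Set V} {X : Finset V} (hX : ∀ v, v ∈ X ↔ v ∈ W)
    {S : Finset (Sym2 V)} :
    X.card.choose 2 - S.card ≤
      (nonEdgePairs ((SimpleGraph.fromEdgeSet (S : Set (Sym2 V))).induce W)).card := by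
  rw [← card_pairsWithin]
  refine (Finset.le_card_sdiff S (pairsWithin X)).trans ?_
  rw [← Finset.card_image_of_injective _ sym2_toFinset_injective]
  refine Finset.card_le_card fun f hf => ?_
  obtain ⟨e, he, rfl⟩ := Finset.mem_image.1 hf
  rw [Finset.mem_sdiff] at he
  induction e using Sym2.ind with
  | _ a b =>
    have hab := mk_mem_pairsWithin.1 he.1
    refine mem_nonEdgePairs.2 ⟨s(⟨a, (hX a).1 hab.1⟩, ⟨b, (hX b).1 hab.2.1⟩), ?_, rfl⟩
    rw [SimpleGraph.mem_edgeSet, SimpleGraph.compl_adj]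
    refine ⟨fun h => hab.2.2 (congrArg Subtype.val h), fun h => he.2 ?_⟩
    simpa using ((SimpleGraph.fromEdgeSet_adj _).1 h).1

/-- Square components on `W₂` with many pairs are simultaneously joined to a common non-edge from
every family `F` of bounded degree, except with small probability. -/
lemma subsetExpect_not_common_le {p c : ℝ} (h0 : 0 < p) (h1 : p ≤ 1) (hc : 0 < c)
    (hn : 1 ≤ Fintype.card V * p ^ 2) (hnc : 72 ≤ c * (Fintype.card V * p ^ 2))
    {X Y : Finset V} {W : Set V} (hY : ∀ v, v ∈ Y ↔ v ∈ W) {H : SimpleGraph W}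
    {F : Finset (Finset V)} (hF : ∀ f ∈ F, f ⊆ X ∧ f.card = 2) {d : ℕ}
    (hd : ∀ v, (F.filter fun f => v ∈ f).card ≤ d) (hdp : d * p ≤ 1)
    [DecidablePred fun T : Finset (V × V) => ∃ C C' : SquareComponent H,
      c * (Fintype.card V : ℝ) ^ 2 ≤ C.size ∧ c * (Fintype.card V : ℝ) ^ 2 ≤ C'.size ∧
        ∀ f ∈ F, (∀ g ∈ C.pairFinset, ¬ f ×ˢ g ⊆ T) ∨ ∀ g ∈ C'.pairFinset, ¬ f ×ˢ g ⊆ T] :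
    subsetExpect p (X ×ˢ Y) (fun T => if ∃ C C' : SquareComponent H,
      c * (Fintype.card V : ℝ) ^ 2 ≤ C.size ∧ c * (Fintype.card V : ℝ) ^ 2 ≤ C'.size ∧
        ∀ f ∈ F, (∀ g ∈ C.pairFinset, ¬ f ×ˢ g ⊆ T) ∨ ∀ g ∈ C'.pairFinset, ¬ f ×ˢ g ⊆ T
        then 1 else 0) ≤
      c⁻¹ * Real.exp (-(c / 72 * (F.card * (Fintype.card V * p ^ 2)))) := by
  classical
  set n : ℝ := (Fintype.card V : ℝ)
  have hn0 : 0 < n := by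
    by_contra! h
    nlinarith [sq_nonneg p]
  set I := (Set.toFinite {C : SquareComponent H | c * n ^ 2 ≤ C.size}).toFinset
  have hI : ∀ C, C ∈ I ↔ c * n ^ 2 ≤ C.size := fun C => by simp [I]
  have hIcard : (I.card : ℝ) ≤ c⁻¹ := by
    have k1 := SquareComponent.card_mul_le_choose I fun C hC => (hI C).1 hC
    have k2 : ((Nat.card W).choose 2 : ℝ) ≤ n ^ 2 := by
      have e1 : (Nat.card W).choose 2 ≤ Nat.card W ^ 2 := Nat.choose_le_pow _ _
      have e2 : Nat.card W ≤ Fintype.card V := by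
        rw [← Nat.card_eq_fintype_card]
        exact Finite.card_subtype_le _
      have : (Nat.card W).choose 2 ≤ Fintype.card V ^ 2 := e1.trans (Nat.pow_le_pow_left e2 2)
      simp only [n]
      exact_mod_cast this
    rw [← one_div, le_div_iff₀ hc]
    have : (I.card * c) * n ^ 2 ≤ 1 * n ^ 2 := by linarith
    exact le_of_mul_le_mul_right this (by positivity)
  -- Subfamilies with at least half of `F`, the possible sets of pairs missing one given component.
  set P := F.powerset.filter fun F' => F.card ≤ 2 * F'.card
  have hPcard : (P.card : ℝ) ≤ 2 ^ F.card := by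
    have : P.card ≤ 2 ^ F.card := (Finset.card_filter_le _ _).trans (Finset.card_powerset F).le
    exact_mod_cast this
  have hP : ∀ F' ∈ P, F' ⊆ F ∧ F.card ≤ 2 * F'.card := fun F' h => by simpa [P] using h
  set ε := Real.exp (-(c / 36 * (F.card * (n * p ^ 2))))
  have hone : ∀ C ∈ I, ∀ F' ∈ P, subsetExpect p (X ×ˢ Y)
      (fun T => if ∀ f ∈ F', ∀ g ∈ C.pairFinset, ¬ f ×ˢ g ⊆ T then 1 else 0) ≤ ε := by
    intro C hC F' hF'
    obtain ⟨hFF, hcard⟩ := hP F' hF'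
    refine (SquareComponent.subsetExpect_no_complete_bipartite_le h0 h1 hn hY ((hI C).1 hC)
      (fun f hf => hF f (hFF hf)) (fun v => le_trans (Finset.card_le_card
        (Finset.filter_subset_filter _ hFF)) (hd v)) hdp).trans ?_
    rw [Real.exp_le_exp, neg_le_neg_iff]
    have k : (F.card : ℝ) ≤ 2 * F'.card := by exact_mod_cast hcard
    have : 0 ≤ c / 36 * (n * p ^ 2) := by positivity
    nlinarith
  have hsum : ∀ T : Finset (V × V), (if ∃ C C' : SquareComponent H, c * n ^ 2 ≤ C.size ∧
      c * n ^ 2 ≤ C'.size ∧ ∀ f ∈ F, (∀ g ∈ C.pairFinset, ¬ f ×ˢ g ⊆ T) ∨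
        ∀ g ∈ C'.pairFinset, ¬ f ×ˢ g ⊆ T then (1 : ℝ) else 0) ≤
      ∑ C ∈ I, ∑ F' ∈ P, if ∀ f ∈ F', ∀ g ∈ C.pairFinset, ¬ f ×ˢ g ⊆ T then 1 else 0 := by
    intro T
    have hnn : ∀ (C : SquareComponent H) (F' : Finset (Finset V)), (0 : ℝ) ≤
        if ∀ f ∈ F', ∀ g ∈ C.pairFinset, ¬ f ×ˢ g ⊆ T then 1 else 0 := fun C F' => by
      split_ifs <;> norm_num
    have hle : ∀ C ∈ I, ∀ F' ∈ P, (∀ f ∈ F', ∀ g ∈ C.pairFinset, ¬ f ×ˢ g ⊆ T) → (1 : ℝ) ≤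
        ∑ C ∈ I, ∑ F' ∈ P, if ∀ f ∈ F', ∀ g ∈ C.pairFinset, ¬ f ×ˢ g ⊆ T then 1 else 0 := by
      intro C hC F' hF' h
      calc (1 : ℝ) = if ∀ f ∈ F', ∀ g ∈ C.pairFinset, ¬ f ×ˢ g ⊆ T then 1 else 0 :=
            (if_pos h).symm
        _ ≤ ∑ F' ∈ P, if ∀ f ∈ F', ∀ g ∈ C.pairFinset, ¬ f ×ˢ g ⊆ T then 1 else 0 :=
            Finset.single_le_sum (f := fun F' => if ∀ f ∈ F', ∀ g ∈ C.pairFinset,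
              ¬ f ×ˢ g ⊆ T then (1 : ℝ) else 0) (fun F' _ => hnn C F') hF'
        _ ≤ _ := Finset.single_le_sum (f := fun C => ∑ F' ∈ P, if ∀ f ∈ F',
              ∀ g ∈ SquareComponent.pairFinset C, ¬ f ×ˢ g ⊆ T then (1 : ℝ) else 0)
              (fun C _ => Finset.sum_nonneg fun F' _ => hnn C F') hC
    split_ifs with h
    · obtain ⟨C, C', hC, hC', hf⟩ := h
      set B := F.filter fun f => ∀ g ∈ C.pairFinset, ¬ f ×ˢ g ⊆ T
      set B' := F.filter fun f => ∀ g ∈ C'.pairFinset, ¬ f ×ˢ g ⊆ T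
      -- Every `f` misses `C` or `C'`, so one of the two families contains at least half of `F`.
      have hBB : F.card ≤ B.card + B'.card := by
        refine le_trans (Finset.card_le_card fun f hfF => ?_) (Finset.card_union_le B B')
        rw [Finset.mem_union, Finset.mem_filter, Finset.mem_filter]
        exact (hf f hfF).imp (fun h => ⟨hfF, h⟩) fun h => ⟨hfF, h⟩
      rcases le_total B'.card B.card with hle' | hle'
      · exact hle C ((hI C).2 hC) B (Finset.mem_filter.2 ⟨Finset.mem_powerset.2
          (Finset.filter_subset _ _), by omega⟩) fun f hf => (Finset.mem_filter.1 hf).2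
      · exact hle C' ((hI C').2 hC') B' (Finset.mem_filter.2 ⟨Finset.mem_powerset.2
          (Finset.filter_subset _ _), by omega⟩) fun f hf => (Finset.mem_filter.1 hf).2
    · exact Finset.sum_nonneg fun C _ => Finset.sum_nonneg fun F' _ => hnn C F'
  refine (subsetExpect_mono h0.le h1 (g := fun T => ∑ C ∈ I, ∑ F' ∈ P,
    if ∀ f ∈ F', ∀ g ∈ C.pairFinset, ¬ f ×ˢ g ⊆ T then 1 else 0) fun T _ => ?_).trans ?_
  · convert hsum T
  rw [subsetExpect_sum]
  simp only [subsetExpect_sum]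
  calc _ ≤ ∑ C ∈ I, ∑ F' ∈ P, ε :=
        Finset.sum_le_sum fun C hC => Finset.sum_le_sum fun F' hF' => hone C hC F' hF'
    _ = I.card * (P.card * ε) := by simp
    _ ≤ c⁻¹ * (2 ^ F.card * ε) := by gcongr
    _ ≤ c⁻¹ * Real.exp (-(c / 72 * (F.card * (n * p ^ 2)))) := by
        refine mul_le_mul_of_nonneg_left ?_ (by positivity)
        -- As `cnp² ≥ 72`, half of the exponent `c|F|np²/36` absorbs this entropy factor.
        have h2 : (2 : ℝ) ^ F.card ≤ Real.exp F.card := by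
          rw [← Real.exp_one_pow]
          exact pow_le_pow_left₀ (by norm_num) (by linarith [Real.exp_one_gt_d9]) _
        calc _ ≤ Real.exp F.card * ε := by gcongr
          _ ≤ _ := by
            rw [← Real.exp_add, Real.exp_le_exp]
            have : (0 : ℝ) ≤ F.card := Nat.cast_nonneg _
            nlinarith

end Joining

/-! ### Merging of all large components on `W₂`. -/

section Merging

variable {V : Type*} [Fintype V] [DecidableEq V]

/-- From `q ≥ m²/8` and `d + 2m ≤ 3m` one gets `s ≥ Mm/24`, and `Mm ≥ n/2`. -/
lemma le_card_of_bounded_degree {n M m : ℝ} {d q s : ℕ} (hM : 0 < M) (hMd : M ≤ d)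
    (hdm : (d : ℝ) ≤ m) (hm2 : 2 ≤ m) (hnm : n / (2 * M) ≤ m) (hq : m * (m - 1) / 4 ≤ q)
    (h : (d * q : ℝ) ≤ s * (d + 2 * m)) : n / 48 ≤ s := by
  have hm0 : 0 < m := by linarith
  have hq' : m ^ 2 / 8 ≤ q := by nlinarith
  have e1 : M * (m ^ 2 / 8) ≤ d * q := mul_le_mul hMd hq' (by positivity) (by positivity)
  have e2 : (s : ℝ) * (d + 2 * m) ≤ s * (3 * m) :=
    mul_le_mul_of_nonneg_left (by linarith) (Nat.cast_nonneg _)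
  have e3 : (M * m / 24) * m ≤ s * m := by nlinarith
  have e4 := le_of_mul_le_mul_right e3 hm0
  rw [div_le_iff₀ (by positivity)] at hnm
  linarith

/-- Square components on `W₂` with many pairs all merge, except with small probability. -/
theorem cond_exists_not_merged_le {p : unitInterval} {c M : ℝ} (h0 : 0 < (p : ℝ))
    (hp : (p : ℝ) ≤ 1 / 12) (hn : 1 ≤ Fintype.card V * (p : ℝ) ^ 2) (hc : 0 < c)
    (hnc : 72 ≤ c * (Fintype.card V * (p : ℝ) ^ 2)) (hM : 0 < M) (hMp : (M + 1) * p ≤ 1)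
    (hMp' : 8 * (M * p) ≤ 1) {W₁ W₂ : Set V} (hW : IsCompl W₁ W₂) (hm2 : 2 ≤ (W₁.ncard : ℝ))
    (hmM : M + 1 ≤ W₁.ncard) (hnm : Fintype.card V / (2 * M) ≤ W₁.ncard) (H : SimpleGraph W₂) :
    (cond (SimpleGraph.binomialRandom V p) {Γ : SimpleGraph V | Γ.induce W₂ = H}).real
        {Γ : SimpleGraph V | ∃ C C' : SquareComponent H, c * (Fintype.card V : ℝ) ^ 2 ≤ C.size ∧
          c * (Fintype.card V : ℝ) ^ 2 ≤ C'.size ∧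
            ¬ InSameSquareComponent Γ C.pairsIn C'.pairsIn} ≤
      Real.exp (-(2 * ((Fintype.card V : ℝ) ^ 2 * (p : ℝ) ^ 2))) +
        c⁻¹ * Real.exp (-(c / 3456 * ((Fintype.card V : ℝ) ^ 2 * (p : ℝ) ^ 2))) := by
  classical
  have h1 : (p : ℝ) ≤ 1 := p.2.2
  have hX : ∀ v, v ∈ W₁.toFinset ↔ v ∈ W₁ := fun v => Set.mem_toFinset
  have hY : ∀ v, v ∈ W₂.toFinset ↔ v ∈ W₂ := fun v => Set.mem_toFinset
  have hcard : W₁.toFinset.card = W₁.ncard := (Set.ncard_eq_toFinset_card' W₁).symm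
  set n : ℝ := (Fintype.card V : ℝ)
  set m : ℝ := (W₁.ncard : ℝ)
  have hn0 : 0 < n := by
    by_contra! h
    nlinarith [sq_nonneg (p : ℝ)]
  have hN : ((pairsWithin W₁.toFinset).card : ℝ) = m * (m - 1) / 2 := by
    rw [card_pairsWithin, hcard, Nat.cast_choose_two]
  refine cond_binomialRandom_real_le hW hX hY
    (fun G T => if ∃ C C' : SquareComponent H, c * n ^ 2 ≤ C.size ∧ c * n ^ 2 ≤ C'.size ∧
      ∀ f ∈ nonEdgePairs G, (∀ g ∈ C.pairFinset, ¬ f ×ˢ g ⊆ T) ∨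
        ∀ g ∈ C'.pairFinset, ¬ f ×ˢ g ⊆ T then 1 else 0) ?_ ?_ ?_
  · exact fun G T => by split_ifs <;> norm_num
  · rintro Γ T hΓ hT ⟨C, C', hC, hC', hnot⟩
    refine le_of_eq (if_pos ⟨C, C', hC, hC', fun f hf => ?_⟩).symm
    by_contra! hcon
    obtain ⟨⟨g, hg, hfg⟩, g', hg', hfg'⟩ := hcon
    obtain ⟨e₀, he₀, rfl⟩ := mem_nonEdgePairs.1 hf
    obtain ⟨e, he, rfl⟩ := SquareComponent.mem_pairFinset.1 hg
    obtain ⟨e', he', rfl⟩ := SquareComponent.mem_pairFinset.1 hg'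
    -- The common component is that of the non-edge `e₀` in `W₁`, joined to both.
    exact hnot ⟨_, C.pairsIn_subset_of_complete hΓ (map_val_mem_compl_edgeSet he₀) he
      (adj_of_product_subset hT hfg), C'.pairsIn_subset_of_complete hΓ
      (map_val_mem_compl_edgeSet he₀) he' (adj_of_product_subset hT hfg')⟩
  · set R := c⁻¹ * Real.exp (-(c / 3456 * (n ^ 2 * (p : ℝ) ^ 2)))
    have hR : 0 ≤ R := by positivity
    calc _ ≤ subsetExpect (p : ℝ) (pairsWithin W₁.toFinset) (fun S =>
          (if (pairsWithin W₁.toFinset).card < 2 * S.card then 1 else 0) + R) := by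
          refine subsetExpect_mono h0.le h1 fun S _ => ?_
          by_cases hS : (pairsWithin W₁.toFinset).card < 2 * S.card
          · rw [if_pos hS]
            refine (subsetExpect_le_of_le h0.le h1 (c := 1) fun T _ => ?_).trans (by linarith)
            split_ifs <;> norm_num
          · rw [if_neg hS, zero_add]
            set Q := nonEdgePairs ((SimpleGraph.fromEdgeSet (S : Set (Sym2 V))).induce W₁)
            have hQ : ∀ f ∈ Q, f ⊆ W₁.toFinset ∧ f.card = 2 := fun f hf =>
              subset_of_mem_nonEdgePairs hX hf
            obtain ⟨F, hFQ, hFd, hFcard⟩ := exists_subset_card_filter_mem_le hQ ⌈M⌉₊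
            have hd : (⌈M⌉₊ : ℝ) ≤ M + 1 := (Nat.ceil_lt_add_one hM.le).le
            have hQcard : m * (m - 1) / 4 ≤ Q.card := by
              have k1 : _ ≤ Q.card := card_sub_card_le_card_nonEdgePairs hX (S := S)
              rw [← card_pairsWithin] at k1
              have k2 : (pairsWithin W₁.toFinset).card ≤ 2 * Q.card := by omega
              have k3 : ((pairsWithin W₁.toFinset).card : ℝ) ≤ 2 * Q.card := by exact_mod_cast k2
              linarith
            have hFn : n / 48 ≤ F.card := by
              refine le_card_of_bounded_degree hM (Nat.le_ceil M) (hd.trans hmM) hm2 hnm hQcard ?_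
              rw [hcard] at hFcard
              simp only [m]
              exact_mod_cast hFcard
            refine le_trans (subsetExpect_mono h0.le h1 (g := fun T =>
              if ∃ C C' : SquareComponent H, c * n ^ 2 ≤ C.size ∧ c * n ^ 2 ≤ C'.size ∧
                ∀ f ∈ F, (∀ g ∈ C.pairFinset, ¬ f ×ˢ g ⊆ T) ∨
                  ∀ g ∈ C'.pairFinset, ¬ f ×ˢ g ⊆ T then 1 else 0) fun T _ => ?_)
              ((subsetExpect_not_common_le h0 h1 hc hn hnc hY (fun f hf => hQ f (hFQ hf)) hFd
                (le_trans (mul_le_mul_of_nonneg_right hd h0.le) hMp)).trans ?_)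
            · split_ifs with h h'
              · exact le_rfl
              · obtain ⟨C, C', hC, hC', hf⟩ := h
                exact absurd ⟨C, C', hC, hC', fun f hfF => hf f (hFQ hfF)⟩ h'
              · exact zero_le_one
              · exact le_rfl
            · refine mul_le_mul_of_nonneg_left (Real.exp_le_exp.2 (neg_le_neg ?_))
                (by positivity)
              have := mul_le_mul_of_nonneg_right hFn
                (by positivity : 0 ≤ c / 72 * (n * (p : ℝ) ^ 2))
              linarith
      _ ≤ Real.exp (-((pairsWithin W₁.toFinset).card / 2)) + R := by
          rw [subsetExpect_add, subsetExpect_const]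
          exact add_le_add_left (subsetExpect_half_le h0.le hp _) _
      _ ≤ _ := by
          refine add_le_add_left (Real.exp_le_exp.2 (neg_le_neg ?_)) _
          rw [hN]
          have k1 : m ^ 2 / 8 ≤ m * (m - 1) / 2 / 2 := by nlinarith
          -- Here `m ≥ n/(2M)` and `Mp ≤ 1/8`; squaring gives `m²/8 ≥ 2n²p²`.
          have k2 : n * p ≤ m / 4 := by
            rw [div_le_iff₀ (by positivity)] at hnm
            nlinarith
          have k3 : (n * p) ^ 2 ≤ (m / 4) ^ 2 := pow_le_pow_left₀ (by positivity) k2 2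
          nlinarith

end Merging

/-! ### Choice of constants and conclusion. -/

/-- Half of each exponent is spent on making its term at most half of the target, which also absorbs
the factor `c⁻¹`. -/
lemma exp_add_mul_exp_le {c κ y : ℝ} (hc : 0 < c) (hκ : 0 < κ) (hy : 1 ≤ y)
    (hy' : Real.log (2 / c) / κ ≤ y) :
    Real.exp (-(2 * y)) + c⁻¹ * Real.exp (-(2 * κ * y)) ≤ Real.exp (-(min κ 1 * y)) := by
  have h1 : Real.exp (-(2 * y)) ≤ 1 / 2 * Real.exp (-(min κ 1 * y)) := by
    have e : Real.exp (-y) ≤ 1 / 2 :=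
      (Real.exp_le_exp.2 (by linarith : -y ≤ -1)).trans (by linarith [Real.exp_neg_one_lt_d9])
    have e' : Real.exp (-y) ≤ Real.exp (-(min κ 1 * y)) :=
      Real.exp_le_exp.2 (neg_le_neg (by nlinarith [min_le_right κ 1]))
    calc Real.exp (-(2 * y)) = Real.exp (-y) * Real.exp (-y) := by rw [← Real.exp_add]; ring_nf
      _ ≤ _ := mul_le_mul e e' (Real.exp_pos _).le (by norm_num)
  have h2 : c⁻¹ * Real.exp (-(2 * κ * y)) ≤ 1 / 2 * Real.exp (-(min κ 1 * y)) := by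
    have e : c⁻¹ * Real.exp (-(κ * y)) ≤ 1 / 2 := by
      rw [div_le_iff₀ hκ, Real.log_le_iff_le_exp (by positivity)] at hy'
      rw [Real.exp_neg, ← mul_inv, one_div]
      refine inv_anti₀ (by norm_num) ?_
      rw [div_le_iff₀ hc] at hy'
      rw [mul_comm κ y]
      linarith
    have e' : Real.exp (-(κ * y)) ≤ Real.exp (-(min κ 1 * y)) :=
      Real.exp_le_exp.2 (neg_le_neg (by nlinarith [min_le_left κ 1]))
    calc c⁻¹ * Real.exp (-(2 * κ * y)) = c⁻¹ * Real.exp (-(κ * y)) * Real.exp (-(κ * y)) := by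
          rw [mul_assoc c⁻¹, ← Real.exp_add]; ring_nf
      _ ≤ _ := mul_le_mul e e' (Real.exp_pos _).le (by norm_num)
  linarith

theorem proposition2p4 (c : ℝ) (hc : 0 < c) :
    ∃ κ : ℝ, 0 < κ ∧
      ∀ (p : ℕ → unitInterval) (M : ℕ → ℝ),
        ((fun n : ℕ => 1 / √(n : ℝ)) =o[atTop] fun n => (p n : ℝ)) →
        (∀ᶠ n : ℕ in atTop, (p n : ℝ) ≤ 100 * (Real.log n / n) ^ (1 / 3 : ℝ)) →
        Tendsto M atTop atTop →
        (M =o[atTop] fun n => ((p n : ℝ))⁻¹) →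
        ∀ᶠ n : ℕ in atTop,
          ∀ W₁ W₂ : Set (Fin n), IsCompl W₁ W₂ → |(W₁.ncard : ℝ) - n / M n| < 1 →
            ∀ H : SimpleGraph W₂,
              (∀ C₂ : SquareComponent H, c * (n : ℝ) ^ 2 ≤ C₂.size →
                (cond (SimpleGraph.binomialRandom (Fin n) (p n))
                    {Γ : SimpleGraph (Fin n) | Γ.induce W₂ = H}).real
                  {Γ : SimpleGraph (Fin n) | ∃ C₁ : SquareComponent (Γ.induce W₁),
                    M n ≤ C₁.size ∧ ¬ InSameSquareComponent Γ C₁.pairsIn C₂.pairsIn} ≤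
                (n : ℝ) ^ 2 / M n ^ 3 * Real.exp (-(κ * (M n * n * (p n : ℝ) ^ 2)))) ∧
              1 - Real.exp (-(κ * ((n : ℝ) ^ 2 * (p n : ℝ) ^ 2))) ≤
                (cond (SimpleGraph.binomialRandom (Fin n) (p n))
                    {Γ : SimpleGraph (Fin n) | Γ.induce W₂ = H}).real
                  {Γ : SimpleGraph (Fin n) | ∀ C₂ C₂' : SquareComponent H, C₂ ≠ C₂' →
                    c * (n : ℝ) ^ 2 ≤ C₂.size → c * (n : ℝ) ^ 2 ≤ C₂'.size →
                    InSameSquareComponent Γ C₂.pairsIn C₂'.pairsIn} := by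
  have hκ : 0 < c / 6912 := by positivity
  refine ⟨min (c / 6912) 1, lt_min hκ one_pos, fun p M hp _ hMtop hM => ?_⟩
  -- Chosen so that `p√n ≥ 1 + 72/c`, which yields both `np² ≥ 1` and `cnp² ≥ 72`.
  set ε : ℝ := (1 + 72 / c)⁻¹
  have hε : 0 < ε := by positivity
  filter_upwards [hp.def hε, hM.def (by norm_num : (0 : ℝ) < 1 / 16),
    hMtop.eventually_ge_atTop 1, eventually_ge_atTop 1,
    tendsto_natCast_atTop_atTop.eventually_ge_atTop (Real.log (2 / c) / (c / 6912))]
    with n h1 h2 hM1 hn1 hnlog W₁ W₂ hW hW₁ H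
  have hp0 : 0 ≤ (p n : ℝ) := (p n).2.1
  have hM0 : 0 < M n := by linarith
  have hn0 : (0 : ℝ) < n := by exact_mod_cast hn1
  rw [Real.norm_of_nonneg (by positivity), Real.norm_of_nonneg hp0,
    div_le_iff₀ (Real.sqrt_pos.2 hn0)] at h1
  have hpos : 0 < (p n : ℝ) := by
    refine lt_of_le_of_ne hp0 fun h => ?_
    rw [← h] at h1
    norm_num at h1
  rw [Real.norm_of_nonneg hM0.le, Real.norm_of_nonneg (by positivity), ← div_eq_mul_inv,
    le_div_iff₀ hpos] at h2
  have hsq : 1 + 72 / c ≤ n * (p n : ℝ) ^ 2 := by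
    have k1 : 1 + 72 / c ≤ p n * √n := by
      have : (1 + 72 / c) * 1 ≤ (1 + 72 / c) * (ε * p n * √n) :=
        mul_le_mul_of_nonneg_left h1 (by positivity)
      rwa [mul_one, mul_assoc ε, mul_inv_cancel_left₀ (by positivity)] at this
    have k2 : (p n * √n) ^ 2 = n * (p n : ℝ) ^ 2 := by
      rw [mul_pow, Real.sq_sqrt hn0.le, mul_comm]
    have k3 : 0 < 72 / c := by positivity
    rw [← k2]
    nlinarith
  have hnp : 1 ≤ n * (p n : ℝ) ^ 2 := by
    have : 0 < 72 / c := by positivity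
    linarith
  have hnc : 72 ≤ c * (n * (p n : ℝ) ^ 2) := by
    have := mul_le_mul_of_nonneg_left hsq hc.le
    rw [mul_add, mul_div_cancel₀ _ hc.ne'] at this
    linarith
  have hp16 : (p n : ℝ) ≤ 1 / 16 := by nlinarith
  have hMp : (M n + 1) * p n ≤ 1 := by nlinarith
  -- From `Mp ≤ 1/16` and `np² ≥ 1`; it makes `n/M` large enough for the rounding in `|W₁|` to be
  -- harmless.
  have hMsq : 256 * M n ≤ n / M n := by
    rw [le_div_iff₀ hM0]
    have k1 : (M n * p n) ^ 2 ≤ (1 / 16) ^ 2 := pow_le_pow_left₀ (by positivity) h2 2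
    have k2 : (256 * M n * M n) * (p n : ℝ) ^ 2 ≤ n * (p n : ℝ) ^ 2 := by nlinarith
    exact le_of_mul_le_mul_right k2 (by positivity)
  obtain ⟨hm1, hm2⟩ := abs_lt.1 hW₁
  have hchoose : (W₁.ncard.choose 2 : ℝ) ≤ (n : ℝ) ^ 2 / M n ^ 2 := by
    rw [Nat.cast_choose_two, ← div_pow]
    nlinarith
  have hhalf : (n : ℝ) / (2 * M n) ≤ W₁.ncard := by
    rw [mul_comm, ← div_div]
    linarith
  refine ⟨fun C₂ hC₂ => ?_, ?_⟩
  · have := cond_exists_not_inSameSquareComponent_le (p := p n) (V := Fin n) hpos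
      (by simpa using hnp) hc hM0 hMp hW (by simpa using hchoose) C₂ (by simpa using hC₂)
    rw [Fintype.card_fin] at this
    refine this.trans (mul_le_mul_of_nonneg_left (Real.exp_le_exp.2 (neg_le_neg ?_))
      (by positivity))
    have k : 0 ≤ M n * n * (p n : ℝ) ^ 2 := by positivity
    have k' := mul_le_mul_of_nonneg_right (min_le_left (c / 6912) 1) k
    nlinarith
  · have hbad := cond_exists_not_merged_le (p := p n) (V := Fin n) hpos (by linarith)
      (by simpa using hnp) hc (by simpa using hnc) hM0 hMp (by linarith) hW (by linarith)
      (by linarith) (by simpa using hhalf) H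
    rw [Fintype.card_fin] at hbad
    set A := {Γ : SimpleGraph (Fin n) | Γ.induce W₂ = H}
    set E := {Γ : SimpleGraph (Fin n) | ∀ C₂ C₂' : SquareComponent H, C₂ ≠ C₂' →
      c * (n : ℝ) ^ 2 ≤ C₂.size → c * (n : ℝ) ^ 2 ≤ C₂'.size →
        InSameSquareComponent Γ C₂.pairsIn C₂'.pairsIn}
    have hA : SimpleGraph.binomialRandom (Fin n) (p n) A ≠ 0 :=
      binomialRandom_ne_zero hpos (by linarith) ⟨H.map (Function.Embedding.subtype _),
        SimpleGraph.comap_map_eq _ _⟩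
    have := cond_isProbabilityMeasure hA
    have hcompl := MeasureTheory.probReal_compl_eq_one_sub
      (μ := cond (SimpleGraph.binomialRandom (Fin n) (p n)) A) (Set.toFinite E).measurableSet
    have hsub : Eᶜ ⊆ {Γ : SimpleGraph (Fin n) | ∃ C C' : SquareComponent H,
        c * (n : ℝ) ^ 2 ≤ C.size ∧ c * (n : ℝ) ^ 2 ≤ C'.size ∧
          ¬ InSameSquareComponent Γ C.pairsIn C'.pairsIn} := by
      intro Γ hΓ
      simp only [E, Set.mem_compl_iff, Set.mem_ofPred_eq] at hΓ
      push Not at hΓ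
      obtain ⟨C, C', -, hC, hC', h⟩ := hΓ
      exact ⟨C, C', hC, hC', h⟩
    have hle := (MeasureTheory.measureReal_mono hsub).trans hbad
    -- As `np² ≥ 1`, the exponent `n²p²` is at least `n`, so it eventually exceeds the threshold
    -- depending on `c`.
    have hy : (n : ℝ) ≤ (n : ℝ) ^ 2 * (p n : ℝ) ^ 2 := by nlinarith
    have hfin := exp_add_mul_exp_le hc hκ (y := (n : ℝ) ^ 2 * (p n : ℝ) ^ 2)
      (le_trans (by exact_mod_cast hn1) hy) (hnlog.trans hy)
    rw [show 2 * (c / 6912) = c / 3456 by ring] at hfin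
    linarith
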